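/- Let $k\ge 2$, $\mathcal X=\{1,\dots,k\}$, let $Q$ be a probability law on $\mathcal X$ with $Q(x)>0$ for all $x$, let $h:\mathcal X\to\mathbb R^d$ and $\alpha\in\mathbb R^d$, and let $$E=\Bigl\{P\in\mathbb R^k:\ P(x)>0\ \forall x,\ \sum_x P(x)=1,\ \sum_x P(x)h(x)=\alpha\Bigr\}.$$ Let $P^*$ be the information projection of $Q$ onto $E$, that is, $P^*\in E$ minimizes $D(P\|Q)=\sum_x P(x)\log\frac{P(x)}{Q(x)}$ over $P\in E$, and let $p^*_{\min}=\min_x P^*(x)$. Let $\mathsf T^*=\{v\in\mathbb R^k:\sum_x v_x=0,\ \sum_x v_x h(x)=0\}$ and $r=\dim\mathsf T^*$, let $\Pi_{\mathsf T^*}$ be the orthogonal projection of $\mathbb R^k$ onto $\mathsf T^*$, and let $H^*=\Pi_{\mathsf T^*}\,\mathrm{diag}(1/P^*)\,\Pi_{\mathsf T^*}$. Let $$\phi_{H^*}(v)=|H^*|^{1/2}(2\pi)^{-r/2}\exp\bigl(-\tfrac12 v^\top H^* v\bigr),\qquad v\in\mathsf T^*,$$ where $|H^*|$ is the determinant of $H^*$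 as an endomorphism of $\mathsf T^*$, and let $dv$ be Lebesgue measure on the Euclidean space $\mathsf T^*$. Assume that the integer vectors in $\mathsf T^*$ span $\mathsf T^*$ (for instance, that $h$ has rational values). Let $X_1,\dots,X_n$ be i.i.d. with law $Q$, and let $P_n$ be their empirical law. Whenever $E$ contains an empirical law of some sample of size $n$, and $m\le n$, let $$\mu_{n,m}(A)=\Pr\bigl((X_1,\dots,X_m)\in A\ \big|\ P_n\in E\bigr),\qquad A\subset\mathcal X^m.$$ For $v\in\mathsf T^*$ let $P(v)=\Pi(P^*+n^{-1/2}v)$, where $\Pi$ is the Euclidean nearest-point projection onto the closure of $E$, and let $P(v)^{\otimes m}$ be the law of $m$ independent draws from $P(v)$. There are constants $C_{\mathrm{geo}}$ and $L$, depending only on $k$, $d$, $p^*_{\min}$ and the matrix $H^*$, with the following property. For all $\eta<1/2$ and $K$ there is an $n_0$, depending only on these quantities and on $\eta$ and $K$, such that for all $n\ge n_0$ for which $E$ contains an empirical law of a sample of size $n$, all $m\le\min(n,Kn^{\eta})$ and all $A\subset\mathcal X^m$, $$\Bigl|\,\mu_{n,m}(A)-\int_{\mathsf T^*}P(v)^{\otimes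 m}(A)\,\phi_{H^*}(v)\,dv\,\Bigr|\ \le\ C_{\mathrm{geo}}\,n^{-1/2}(\log n)^{L},$$ and the integrand is integrable. -/

import Mathlib

open MeasureTheory

noncomputable section

namespace TiltedDeFinetti

/-- `ℝ^k` with its Euclidean structure; laws on `{1,…,k}` are vectors in it. -/
abbrev Vec (k : ℕ) : Type := EuclideanSpace ℝ (Fin k)

/-- The moment map `P ↦ A P = ∑ₓ P(x) h(x)`, where the columns of `A` are the features `h(x)`. -/
def moment {k d : ℕ} (h : Fin k → Fin d → ℝ) (P : Vec k) : Fin d → ℝ :=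
  ∑ x, P x • h x

/-- The open probability simplex. -/
def openSimplex (k : ℕ) : Set (Vec k) :=
  {P | (∀ x, 0 < P x) ∧ ∑ x, P x = 1}

/-- The feasible set `E` of strictly positive laws with moments `α`. -/
def feasible {k d : ℕ} (h : Fin k → Fin d → ℝ) (α : Fin d → ℝ) : Set (Vec k) :=
  {P | P ∈ openSimplex k ∧ moment h P = α}

/-- The closed version of `E`: all laws, possibly with zero weights, with moments `α`. -/
def closedFeasible {k d : ℕ} (h : Fin k → Fin d → ℝ) (α : Fin d → ℝ) : Set (Vec k) :=
  {P | (∀ x, 0 ≤ P x) ∧ ∑ x, P x = 1 ∧ moment h P = α}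

/-- The Kullback–Leibler divergence `D(P‖Q)` of strictly positive laws. -/
def klDivergence {k : ℕ} (P Q : Vec k) : ℝ :=
  ∑ x, P x * Real.log (P x / Q x)

/-- `Pstar` is the information projection of `Q` onto `E`. -/
def IsIProjection {k d : ℕ} (Q : Vec k) (h : Fin k → Fin d → ℝ) (α : Fin d → ℝ)
    (Pstar : Vec k) : Prop :=
  Pstar ∈ feasible h α ∧ ∀ P ∈ feasible h α, klDivergence Pstar Q ≤ klDivergence P Q

/-- The tangent space `T* = {v : 1ᵀ v = 0, A v = 0}`. -/
def tangentSpace {k d : ℕ} (h : Fin k → Fin d → ℝ) : Submodule ℝ (Vec k) where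
  carrier := {v | ∑ x, v x = 0 ∧ moment h v = 0}
  add_mem' := by
    rintro v w ⟨hv, hv'⟩ ⟨hw, hw'⟩
    simp only [moment] at hv' hw'
    constructor
    · simp [Finset.sum_add_distrib, hv, hw]
    · simp [moment, add_smul, Finset.sum_add_distrib, hv', hw']
  zero_mem' := by simp [moment]
  smul_mem' := by
    rintro c v ⟨hv, hv'⟩
    simp only [moment] at hv'
    constructor
    · simp [← Finset.mul_sum, hv]
    · simp [moment, mul_smul, ← Finset.smul_sum, hv']

/-- The integer vectors of `T*` span `T*`. These vectors are the differences of
vectors of counts with the same sample size and the same moments. The condition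
holds, for example, whenever `h` has rational values. -/
def HasFullTypeLattice {k d : ℕ} (h : Fin k → Fin d → ℝ) : Prop :=
  Submodule.span ℝ {v : Vec k | v ∈ tangentSpace h ∧ ∀ x, ∃ z : ℤ, v x = z} = tangentSpace h

/-- The ambient Hessian `diag(1/P)` of `P ↦ D(P‖Q)`. -/
def ambientHessian {k : ℕ} (P : Vec k) : Vec k →ₗ[ℝ] Vec k :=
  Matrix.toEuclideanLin (Matrix.diagonal fun x => 1 / P x)

/-- The orthogonal projection of `ℝ^k` onto `T*`, as an endomorphism of `ℝ^k`. -/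
def tangentProjection {k d : ℕ} (h : Fin k → Fin d → ℝ) : Vec k →ₗ[ℝ] Vec k :=
  ((tangentSpace h).starProjection : Vec k →L[ℝ] Vec k)

/-- The projected Hessian `H* = Π diag(1/P) Π` on `ℝ^k`, with `Π` the projection onto `T*`. -/
def projectedHessian {k d : ℕ} (h : Fin k → Fin d → ℝ) (P : Vec k) : Vec k →ₗ[ℝ] Vec k :=
  tangentProjection h ∘ₗ ambientHessian P ∘ₗ tangentProjection h

theorem projectedHessian_mem {k d : ℕ} (h : Fin k → Fin d → ℝ) (P v : Vec k) :
    projectedHessian h P v ∈ tangentSpace h :=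
  Submodule.starProjection_apply_mem _ _

/-- `H*` as an endomorphism of `T*`. -/
def tangentHessian {k d : ℕ} (h : Fin k → Fin d → ℝ) (P : Vec k) :
    tangentSpace h →ₗ[ℝ] tangentSpace h :=
  (projectedHessian h P).restrict fun v _ => projectedHessian_mem h P v

/-- The centred Gaussian density on `T*` with precision `H*`. -/
def gaussianDensity {k d : ℕ} (h : Fin k → Fin d → ℝ) (P : Vec k) (v : tangentSpace h) : ℝ :=
  Real.sqrt (LinearMap.det (tangentHessian h P)) *
    (2 * Real.pi) ^ (-(Module.finrank ℝ (tangentSpace h) : ℝ) / 2) *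
    Real.exp (-(1 / 2) * inner ℝ v (tangentHessian h P v))

/-- Lebesgue measure on the Euclidean space `T*`: the Haar measure that gives the unit cube
of an orthonormal basis measure one. -/
def tangentLebesgue {k d : ℕ} (h : Fin k → Fin d → ℝ) : Measure (tangentSpace h) :=
  (stdOrthonormalBasis ℝ (tangentSpace h)).toBasis.addHaar

/-- A point of `S` nearest to `y`; for `S` nonempty, closed and convex this is the
metric projection. -/
def nearestPoint {k : ℕ} (S : Set (Vec k)) (y : Vec k) : Vec k :=
  Classical.epsilon fun p => p ∈ S ∧ ∀ q ∈ S, ‖y - p‖ ≤ ‖y - q‖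

/-- The local chart `P(v) = Π(P* + n^{-1/2} v)`, with `Π` the metric projection onto the
closure of `E`, so that `P(v) = P* + n^{-1/2} v` as long as this is a law. -/
def localChart {k d : ℕ} (h : Fin k → Fin d → ℝ) (α : Fin d → ℝ) (Pstar : Vec k) (n : ℕ)
    (v : tangentSpace h) : Vec k :=
  nearestPoint (closedFeasible h α) (Pstar + (Real.sqrt n)⁻¹ • (v : Vec k))

/-- The probability `P^{⊗m}(A)` of `A` under `m` independent draws from `P`. -/
def iidProb {k : ℕ} (P : Vec k) (m : ℕ) (A : Set (Fin m → Fin k)) : ℝ :=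
  ∑ x : Fin m → Fin k, A.indicator (fun y => ∏ i, P (y i)) x

/-- The empirical law `P_n` of a sample of size `n`. -/
def empirical {k n : ℕ} (x : Fin n → Fin k) : Vec k :=
  WithLp.toLp 2 fun a => ((Finset.univ.filter fun i => x i = a).card : ℝ) / n

/-- The samples of size `n` whose empirical law lies in `E`. -/
def constraintEvent {k d : ℕ} (h : Fin k → Fin d → ℝ) (α : Fin d → ℝ) (n : ℕ) :
    Set (Fin n → Fin k) :=
  {x | empirical x ∈ feasible h α}

/-- The constrained predictive law `μ_{n,m}(A) = Pr(X_{1:m} ∈ A ∣ P_n ∈ E)`, where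
`X_1,…,X_n` are independent draws from `Q`. -/
def predictiveLaw {k d : ℕ} (Q : Vec k) (h : Fin k → Fin d → ℝ) (α : Fin d → ℝ)
    {n m : ℕ} (hmn : m ≤ n) (A : Set (Fin m → Fin k)) : ℝ :=
  iidProb Q n (constraintEvent h α n ∩ {x | (fun i => x (Fin.castLE hmn i)) ∈ A}) /
    iidProb Q n (constraintEvent h α n)

end TiltedDeFinetti

end

/-! Given its vector of counts `N`, an i.i.d. sample is uniform on a type class, so its first `m`
letters are draws without replacement from a population of composition `N`. The first-order
condition for `P*` makes `log (P*/Q)` orthogonal to `T*`; hence the likelihood ratio of `Q` to `P*`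
is constant on the event `P_n ∈ E`, and the conditioning may be done under `P*`. The predictive law
is therefore an average of without-replacement laws over the types in `n P* + T*`, weighted by
multinomial probabilities under `P*` (`predictiveLaw_eq_sum_types`).

Two estimates turn this average into the Gaussian mixture. First, draws without replacement from `N`
differ from independent draws from `N/n` by `O(m/n)`, which is `O(n^{-1/2})` because `m ≤ √n` for
large `n` (`abs_withoutReplacementProb_sub_iidProb_le`). The terms of order `m²/n` cancel and leave
a chi-square statistic whose mean is of order `m`. Second, Stirling's formula shows that for `‖N - n
P*‖ ≤ √n R` the weight is a factor common to all types times `exp(-½ ∑ v_a²/P*_a)` at `v = (N - n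
P*)/√n`, up to a relative error `O(R³/√n)` (`abs_log_typeWeight_sub_le`). A cruder bound valid for
all types controls the rest (`typeWeight_le`). With `R = log n` all tails are smaller than any power
of `n`, and the rate is `n^{-1/2} (log n)³`.

Since the integer vectors span `T*`, the offsets `N - n P*` lie in a translate of a full lattice.
Its scaled cells have equal volume and tile the central region, so the sum over types is a Riemann
sum (`abs_average_sub_average_le`). Both averages are quotients, so neither the common factor nor
the cell volume has to be evaluated. The constants depend on `T*`, `p*_min` and `k` only, and `T*`
is the range of `H*` (`tangentSpace_eq_range_projectedHessian`). -/

open MeasureTheory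

noncomputable section

namespace TiltedDeFinetti

open Finset

/-! ### Type classes and draws without replacement -/

/-- The vector of counts of a sample. -/
def typeCount {n k : ℕ} (x : Fin n → Fin k) (a : Fin k) : ℕ :=
  (univ.filter fun i => x i = a).card

theorem typeCount_eq_sum {n k : ℕ} (x : Fin n → Fin k) (a : Fin k) :
    typeCount x a = ∑ i, if x i = a then 1 else 0 := by
  simp [typeCount]

theorem sum_typeCount {n k : ℕ} (x : Fin n → Fin k) : ∑ a, typeCount x a = n := by
  simp only [typeCount_eq_sum]
  rw [sum_comm]
  simp

theorem typeCount_le {n k : ℕ} (x : Fin n → Fin k) (a : Fin k) : typeCount x a ≤ n := by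
  simpa [typeCount] using card_le_univ (univ.filter fun i => x i = a)

theorem prod_comp_eq_prod_pow {n k : ℕ} {M : Type*} [CommMonoid M] (x : Fin n → Fin k)
    (f : Fin k → M) : ∏ i, f (x i) = ∏ a, f a ^ typeCount x a := by
  rw [← prod_fiberwise univ x]
  refine prod_congr rfl fun a _ => ?_
  rw [typeCount, ← prod_const]
  exact prod_congr rfl fun i hi => by rw [(mem_filter.1 hi).2]

theorem typeCount_cons {n k : ℕ} (a : Fin k) (y : Fin n → Fin k) :
    typeCount (Fin.cons a y : Fin (n + 1) → Fin k) = typeCount y + Pi.single a 1 := by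
  funext b
  simp only [typeCount_eq_sum, Fin.sum_univ_succ, Fin.cons_zero, Fin.cons_succ, Pi.add_apply,
    Pi.single_apply]
  rw [add_comm]
  simp [eq_comm]

theorem typeCount_append {m l k : ℕ} (y : Fin m → Fin k) (z : Fin l → Fin k) :
    typeCount (Fin.append y z) = typeCount y + typeCount z := by
  funext b
  simp only [typeCount_eq_sum, Fin.sum_univ_add, Pi.add_apply, Fin.append_left, Fin.append_right]

/-- The samples with a given vector of counts. -/
def typeClass {k : ℕ} (n : ℕ) (N : Fin k → ℕ) : Finset (Fin n → Fin k) :=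
  univ.filter fun x => typeCount x = N

/-- The multinomial coefficient, by splitting on the first letter: removing a letter `a` from `N`
divides the product of factorials by `N a`, and `∑ N a = n + 1` restores the missing factor of `(n +
1)!`. -/
theorem card_typeClass_mul {k : ℕ} (n : ℕ) (N : Fin k → ℕ) (hN : ∑ a, N a = n) :
    (typeClass n N).card * ∏ a, (N a).factorial = n.factorial := by
  induction n generalizing N with
  | zero =>
    have h0 : N = 0 := by
      funext a
      exact (sum_eq_zero_iff.1 hN) a (mem_univ a)
    subst h0
    have : typeClass 0 (0 : Fin k → ℕ) = univ := by
      ext x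
      simp only [typeClass, mem_filter, mem_univ, true_and, iff_true]
      funext a
      simp [typeCount]
    simp [this]
  | succ n ih =>
    have key : (typeClass (n + 1) N).card =
        ∑ a, (univ.filter fun y : Fin n → Fin k => typeCount y + Pi.single a 1 = N).card := by
      rw [typeClass, card_filter, ← (Fin.consEquiv fun _ => Fin k).sum_comp,
        Fintype.sum_prod_type]
      refine sum_congr rfl fun a _ => ?_
      rw [card_filter]
      refine sum_congr rfl fun y _ => ?_
      rw [← typeCount_cons]
      rfl
    rw [key, sum_mul, Nat.factorial_succ, ← hN, sum_mul]
    refine sum_congr rfl fun a _ => ?_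
    rcases Nat.eq_zero_or_pos (N a) with h0 | hpos
    · rw [h0, zero_mul, Nat.mul_eq_zero]
      left
      rw [card_eq_zero, filter_eq_empty_iff]
      intro y _ h
      have := congrFun h a
      simp [h0] at this
    · obtain ⟨M, rfl⟩ : ∃ M : Fin k → ℕ, N = M + Pi.single a 1 := by
        refine ⟨N - Pi.single a 1, ?_⟩
        funext b
        by_cases hb : b = a
        · subst hb; simp; omega
        · simp [hb]
      have hM : ∑ b, M b = n := by
        simp only [Pi.add_apply, sum_add_distrib] at hN
        rw [sum_pi_single'] at hN
        simpa using hN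
      have := ih M hM
      have e1 : (univ.filter fun y : Fin n → Fin k =>
          typeCount y + Pi.single a 1 = M + Pi.single a 1) = typeClass n M := by
        ext y; simp [typeClass]
      rw [e1, ← this]
      have e2 : ∏ b, ((M + Pi.single a 1 : Fin k → ℕ) b).factorial =
          (M a + 1) * ∏ b, (M b).factorial := by
        rw [← mul_prod_erase univ _ (mem_univ a), ← mul_prod_erase univ (fun b => (M b).factorial)
          (mem_univ a)]
        have : ∏ b ∈ univ.erase a, ((M + Pi.single a 1 : Fin k → ℕ) b).factorial =
            ∏ b ∈ univ.erase a, (M b).factorial :=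
          prod_congr rfl fun b hb => by simp [ne_of_mem_erase hb]
        rw [this]
        simp [Nat.factorial_succ]
        ring
      rw [e2]
      simp
      ring

theorem typeClass_nonempty {k n : ℕ} {N : Fin k → ℕ} (hN : ∑ a, N a = n) :
    (typeClass n N).Nonempty := by
  rw [← card_pos]
  have := card_typeClass_mul n N hN
  have h2 := Nat.factorial_pos n
  rw [← this] at h2
  exact Nat.pos_of_mul_pos_right h2

/-- The number of samples of given type and with a given initial segment. -/
theorem card_typeClass_prefix_mul {k m n : ℕ} (hmn : m ≤ n) (N : Fin k → ℕ) (hN : ∑ a, N a = n)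
    (y : Fin m → Fin k) (hy : typeCount y ≤ N) :
    ((typeClass n N).filter fun x => (fun i => x (Fin.castLE hmn i)) = y).card *
      ∏ a, (N a - typeCount y a).factorial = (n - m).factorial := by
  obtain ⟨l, rfl⟩ := Nat.exists_eq_add_of_le hmn
  have hs : ∑ a, (N a - typeCount y a) = l := by
    have : ∑ a, (N a - typeCount y a) + ∑ a, typeCount y a = ∑ a, N a := by
      rw [← sum_add_distrib]
      exact sum_congr rfl fun a _ => Nat.sub_add_cancel (hy a)
    rw [sum_typeCount, hN] at this
    omega
  rw [Nat.add_sub_cancel_left, ← card_typeClass_mul l _ hs]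
  congr 1
  symm
  -- A sample with prefix `y` has type `N` exactly when its remaining part has type `N - typeCount
  -- y`.
  refine card_bij (fun z _ => Fin.append y z) ?_ ?_ ?_
  · intro z hz
    simp only [typeClass, mem_filter, mem_univ, true_and] at hz ⊢
    refine ⟨?_, ?_⟩
    · rw [typeCount_append, hz]
      funext a
      exact Nat.add_sub_cancel' (hy a)
    · funext i
      exact Fin.append_left y z i
  · intro z _ z' _ h
    funext i
    have := congrFun h (Fin.natAdd m i)
    simpa using this
  · intro x hx
    simp only [typeClass, mem_filter, mem_univ, true_and] at hx ⊢
    refine ⟨fun i => x (Fin.natAdd m i), ?_, ?_⟩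
    · have hx2 : x = Fin.append y (fun i => x (Fin.natAdd m i)) := by
        rw [← hx.2]
        exact (Fin.append_castAdd_natAdd (f := x)).symm
      have h1 := hx.1
      rw [hx2, typeCount_append] at h1
      funext a
      have := congrFun h1 a
      simp only [Pi.add_apply] at this
      omega
    · rw [← hx.2]
      exact Fin.append_castAdd_natAdd (f := x)

/-- The probability of `A` under `m` draws without replacement from a population of
composition `N`. -/
def withoutReplacementProb {k : ℕ} {n m : ℕ} (hmn : m ≤ n) (N : Fin k → ℕ)
    (A : Set (Fin m → Fin k)) : ℝ :=
  open Classical in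
  (((typeClass n N).filter fun x => (fun i => x (Fin.castLE hmn i)) ∈ A).card : ℝ) /
    (typeClass n N).card

theorem withoutReplacementProb_nonneg {k : ℕ} {n m : ℕ} (hmn : m ≤ n) (N : Fin k → ℕ)
    (A : Set (Fin m → Fin k)) : 0 ≤ withoutReplacementProb hmn N A := by
  unfold withoutReplacementProb
  positivity

theorem withoutReplacementProb_le_one {k : ℕ} {n m : ℕ} (hmn : m ≤ n) (N : Fin k → ℕ)
    (A : Set (Fin m → Fin k)) : withoutReplacementProb hmn N A ≤ 1 := by
  classical
  unfold withoutReplacementProb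
  refine div_le_one_of_le₀ ?_ (by positivity)
  exact_mod_cast card_filter_le _ _

theorem withoutReplacementProb_eq_sum {k : ℕ} {n m : ℕ} (hmn : m ≤ n) (N : Fin k → ℕ)
    (A : Set (Fin m → Fin k)) : withoutReplacementProb hmn N A =
      ∑ y, A.indicator (fun y => withoutReplacementProb hmn N {y}) y := by
  classical
  have : ((typeClass n N).filter fun x => (fun i => x (Fin.castLE hmn i)) ∈ A).card =
      ∑ y ∈ univ.filter (· ∈ A),
        ((typeClass n N).filter fun x => (fun i => x (Fin.castLE hmn i)) = y).card := by
    rw [card_eq_sum_card_fiberwise (f := fun x => (fun i => x (Fin.castLE hmn i)))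
      (t := univ.filter (· ∈ A))]
    · refine sum_congr rfl fun y hy => ?_
      congr 1
      ext x
      simp only [mem_filter, mem_univ, true_and] at hy ⊢
      constructor
      · rintro ⟨⟨h1, _⟩, h3⟩; exact ⟨h1, h3⟩
      · rintro ⟨h1, h3⟩; exact ⟨⟨h1, h3 ▸ hy⟩, h3⟩
    · intro x hx
      simpa using (mem_filter.1 hx).2
  simp only [withoutReplacementProb, Set.mem_singleton_iff, Set.indicator_apply]
  rw [← sum_filter, this, Nat.cast_sum, sum_div]

theorem withoutReplacementProb_univ {k : ℕ} {n m : ℕ} (hmn : m ≤ n) (N : Fin k → ℕ)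
    (hN : ∑ a, N a = n) : withoutReplacementProb hmn N Set.univ = 1 := by
  have := card_pos.2 (typeClass_nonempty hN)
  simp only [withoutReplacementProb, Set.mem_univ, filter_true]
  field_simp

/-- The multinomial count of the possible suffixes is divided by that of all samples, and the
quotients of factorials are falling factorials. -/
theorem withoutReplacementProb_singleton {k : ℕ} {n m : ℕ} (hmn : m ≤ n) (N : Fin k → ℕ)
    (hN : ∑ a, N a = n) (y : Fin m → Fin k) (hy : typeCount y ≤ N) :
    withoutReplacementProb hmn N {y} =
      (∏ a, ((N a).descFactorial (typeCount y a) : ℝ)) / n.descFactorial m := by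
  classical
  have h1 := card_typeClass_mul n N hN
  have h2 := card_typeClass_prefix_mul hmn N hN y hy
  have h3 := Nat.factorial_mul_descFactorial hmn
  have h4 : (∏ a, (N a - typeCount y a).factorial) * ∏ a, (N a).descFactorial (typeCount y a) =
      ∏ a, (N a).factorial := by
    rw [← prod_mul_distrib]
    exact prod_congr rfl fun a _ => Nat.factorial_mul_descFactorial (hy a)
  have hc := card_pos.2 (typeClass_nonempty hN)
  have hd : 0 < n.descFactorial m := Nat.descFactorial_pos.2 hmn
  simp only [withoutReplacementProb, Set.mem_singleton_iff]
  rw [div_eq_div_iff (by positivity) (by positivity)]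
  set c := (typeClass n N).card
  set e := ((typeClass n N).filter fun x => (fun i => x (Fin.castLE hmn i)) = y).card with he
  have hF : 0 < ∏ a, (N a - typeCount y a).factorial := prod_pos fun a _ => Nat.factorial_pos _
  have : e * n.descFactorial m = (∏ a, (N a).descFactorial (typeCount y a)) * c := by
    apply Nat.eq_of_mul_eq_mul_right hF
    calc _ = (e * ∏ a, (N a - typeCount y a).factorial) * n.descFactorial m := by ring
      _ = n.factorial := by rw [h2, h3]
      _ = c * ((∏ a, (N a - typeCount y a).factorial) *
          ∏ a, (N a).descFactorial (typeCount y a)) := by rw [h4, h1]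
      _ = _ := by ring
  exact_mod_cast this

/-! ### Conditioning on the type, and the change of measure from `Q` to `P*` -/

/-- The probability of a type class under independent draws from `P`. -/
def typeWeight {k : ℕ} (P : Vec k) (n : ℕ) (N : Fin k → ℕ) : ℝ :=
  (typeClass n N).card * ∏ a, P a ^ N a

open Classical in
/-- The strictly positive vectors of counts of samples of size `n` that lie in `n P + T`. -/
def types {k : ℕ} (T : Submodule ℝ (Vec k)) (P : Vec k) (n : ℕ) : Finset (Fin k → ℕ) :=
  (Fintype.piFinset fun _ => range (n + 1)).filter fun N =>
    ∑ a, N a = n ∧ (∀ a, 0 < N a) ∧ WithLp.toLp 2 (fun a => (N a : ℝ)) - (n : ℝ) • P ∈ T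

theorem mem_types {k : ℕ} {T : Submodule ℝ (Vec k)} {P : Vec k} {n : ℕ} {N : Fin k → ℕ} :
    N ∈ types T P n ↔ ∑ a, N a = n ∧ (∀ a, 0 < N a) ∧
      WithLp.toLp 2 (fun a => (N a : ℝ)) - (n : ℝ) • P ∈ T := by
  classical
  simp only [types, mem_filter, Fintype.mem_piFinset, mem_range, and_iff_right_iff_imp]
  rintro ⟨h, -⟩ a
  rw [← h]
  exact Nat.lt_succ_of_le (single_le_sum (fun _ _ => Nat.zero_le _) (mem_univ a))

theorem card_types_le {k : ℕ} (T : Submodule ℝ (Vec k)) (P : Vec k) (n : ℕ) :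
    (types T P n).card ≤ (n + 1) ^ k := by
  classical
  refine (card_filter_le _ _).trans ?_
  simp

/-- With one feasible base point, `h` and `α` enter only through the tangent space; this is what
allows the estimates below to be stated for a subspace `T`. -/
theorem mem_feasible_iff {k d : ℕ} {h : Fin k → Fin d → ℝ} {α : Fin d → ℝ} {P R : Vec k}
    (hP : P ∈ feasible h α) :
    R ∈ feasible h α ↔ (∀ a, 0 < R a) ∧ R - P ∈ tangentSpace h := by
  obtain ⟨⟨hP1, hP2⟩, hP3⟩ := hP
  have hm : moment h (R - P) = moment h R - moment h P := by
    simp [moment, sub_smul, sum_sub_distrib]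
  have hs : ∑ a, (R - P) a = ∑ a, R a - ∑ a, P a := by simp [sum_sub_distrib]
  change ((_ ∧ _) ∧ _) ↔ _ ∧ (_ ∧ _)
  rw [hm, hs, hP2, hP3, sub_eq_zero, sub_eq_zero, and_assoc]

theorem empirical_apply {k n : ℕ} (x : Fin n → Fin k) (a : Fin k) :
    empirical x a = (typeCount x a : ℝ) / n := rfl

theorem mem_constraintEvent_iff {k d n : ℕ} {h : Fin k → Fin d → ℝ} {α : Fin d → ℝ} {P : Vec k}
    (hP : P ∈ feasible h α) (hn : 0 < n) (x : Fin n → Fin k) :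
    x ∈ constraintEvent h α n ↔ typeCount x ∈ types (tangentSpace h) P n := by
  have hn' : (0 : ℝ) < n := by exact_mod_cast hn
  have e : WithLp.toLp 2 (fun a => (typeCount x a : ℝ)) - (n : ℝ) • P =
      (n : ℝ) • (empirical x - P) := by
    ext a
    simp [empirical_apply]
    field_simp
  rw [constraintEvent, Set.mem_ofPred_eq, mem_feasible_iff hP, mem_types, e,
    Submodule.smul_mem_iff _ hn'.ne']
  simp only [sum_typeCount, true_and, empirical_apply]
  refine and_congr_left fun _ => forall_congr' fun a => ?_
  rw [div_pos_iff_of_pos_right hn', Nat.cast_pos]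

/-- The counts are a sufficient statistic: all samples of one type are equally likely, and the
constraint event is a union of type classes. -/
theorem iidProb_eq_sum_types {k d n m : ℕ} {h : Fin k → Fin d → ℝ} {α : Fin d → ℝ} {P : Vec k}
    (hP : P ∈ feasible h α) (hn : 0 < n) (hmn : m ≤ n) (A : Set (Fin m → Fin k)) :
    iidProb P n (constraintEvent h α n ∩ {x | (fun i => x (Fin.castLE hmn i)) ∈ A}) =
      ∑ N ∈ types (tangentSpace h) P n, typeWeight P n N * withoutReplacementProb hmn N A := by
  classical
  simp only [iidProb, Set.indicator_apply]
  rw [← sum_filter, ← sum_fiberwise_of_maps_to (g := typeCount)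
    (t := types (tangentSpace h) P n)]
  · refine sum_congr rfl fun N hN => ?_
    have hc := card_pos.2 (typeClass_nonempty (mem_types.1 hN).1)
    rw [typeWeight, withoutReplacementProb, mul_right_comm, mul_div_cancel₀ _ (by positivity)]
    rw [← nsmul_eq_mul, ← sum_const]
    refine sum_congr ?_ ?_
    · ext x
      simp only [mem_filter, mem_univ, true_and, Set.mem_inter_iff, Set.mem_ofPred_eq, typeClass,
        mem_constraintEvent_iff hP hn]
      constructor
      · rintro ⟨⟨_, h2⟩, h3⟩; exact ⟨h3, h2⟩
      · rintro ⟨rfl, h2⟩; exact ⟨⟨hN, h2⟩, rfl⟩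
    · intro x hx
      rw [prod_comp_eq_prod_pow x fun a => P a, (mem_filter.1 (mem_filter.1 hx).1).2]
  · intro x hx
    exact (mem_constraintEvent_iff hP hn x).1 (mem_filter.1 hx).2.1

/-- The first-order condition for the information projection: `log (P* / Q)` is orthogonal to the
tangent space. -/
theorem IsIProjection.sum_mul_log_eq_zero {k d : ℕ} {Q P : Vec k} {h : Fin k → Fin d → ℝ}
    {α : Fin d → ℝ} (hQ : Q ∈ openSimplex k) (hP : IsIProjection Q h α P) {v : Vec k}
    (hv : v ∈ tangentSpace h) : ∑ a, v a * Real.log (P a / Q a) = 0 := by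
  have hpos : ∀ a, 0 < P a := hP.1.1.1
  have hder : HasDerivAt (fun t : ℝ => klDivergence (P + t • v) Q)
      (∑ a, (v a * Real.log (P a / Q a) + v a)) 0 := by
    have : (fun t : ℝ => klDivergence (P + t • v) Q) =
        fun t => ∑ a, (P a + t * v a) * Real.log ((P a + t * v a) / Q a) := by
      funext t; simp [klDivergence]
    rw [this]
    refine HasDerivAt.fun_sum fun a _ => ?_
    have h1 : HasDerivAt (fun t : ℝ => P a + t * v a) (v a) 0 := by
      simpa using ((hasDerivAt_id (0 : ℝ)).mul_const (v a)).const_add (P a)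
    have hq := (hQ.1 a).ne'
    have hp := (hpos a).ne'
    have h2 := h1.mul ((h1.div_const (Q a)).log (by simp [hp, hq]))
    refine h2.congr_deriv ?_
    simp
    field_simp
  -- Strict positivity is an open condition, so both signs of `t` are admissible and the minimum at
  -- `0` is interior.
  have hmin : IsLocalMin (fun t : ℝ => klDivergence (P + t • v) Q) 0 := by
    have hev : ∀ᶠ t : ℝ in nhds 0, ∀ a, 0 < (P + t • v) a := by
      rw [Filter.eventually_all]
      intro a
      have hc : ContinuousAt (fun t : ℝ => (P + t • v) a) 0 := by
        simp only [PiLp.add_apply, PiLp.smul_apply, smul_eq_mul]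
        fun_prop
      exact hc.eventually (lt_mem_nhds (by simpa using hpos a))
    filter_upwards [hev] with t ht
    simp only [zero_smul, add_zero]
    refine hP.2 _ ((mem_feasible_iff hP.1).2 ⟨ht, ?_⟩)
    simpa using Submodule.smul_mem _ t hv
  have := hmin.hasDerivAt_eq_zero hder
  -- The derivative of `x log (x/q)` is `log (x/q) + 1`; the constant contributes `∑ v_a = 0`.
  rw [sum_add_distrib, hv.1, add_zero] at this
  exact this

/-- The log-likelihood ratio is `∑ N_a log (P_a/Q_a)`. On the event `N - n P` is tangent, so by the
first-order condition `N` may be replaced by `n P`. -/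
theorem prod_eq_mul_prod_of_mem_constraintEvent {k d n : ℕ} {Q P : Vec k}
    {h : Fin k → Fin d → ℝ} {α : Fin d → ℝ} (hQ : Q ∈ openSimplex k) (hP : IsIProjection Q h α P)
    (hn : 0 < n) {x : Fin n → Fin k} (hx : x ∈ constraintEvent h α n) :
    ∏ i, Q (x i) = Real.exp (-(n * klDivergence P Q)) * ∏ i, P (x i) := by
  have hpos : ∀ a, 0 < P a := hP.1.1.1
  have h0 := hP.sum_mul_log_eq_zero hQ ((mem_types.1 ((mem_constraintEvent_iff hP.1 hn x).1 hx)).2.2)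
  have h1 : ∑ a, (typeCount x a : ℝ) * Real.log (P a / Q a) = n * klDivergence P Q := by
    simp only [PiLp.sub_apply, PiLp.smul_apply, smul_eq_mul, sub_mul, sum_sub_distrib] at h0
    rw [klDivergence, mul_sum]
    simp only [← mul_assoc]
    linarith
  have h2 : ∏ i, P (x i) = Real.exp (n * klDivergence P Q) * ∏ i, Q (x i) := by
    rw [prod_comp_eq_prod_pow x fun a => P a, prod_comp_eq_prod_pow x fun a => Q a, ← h1,
      Real.exp_sum, ← prod_mul_distrib]
    refine prod_congr rfl fun a _ => ?_
    rw [mul_comm (typeCount x a : ℝ), Real.exp_mul, Real.exp_log (div_pos (hpos a) (hQ.1 a)),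
      Real.rpow_natCast, ← mul_pow, div_mul_cancel₀ _ (hQ.1 a).ne']
  rw [h2, ← mul_assoc, ← Real.exp_add]
  simp

theorem iidProb_constraintEvent_inter {k d n : ℕ} {Q P : Vec k}
    {h : Fin k → Fin d → ℝ} {α : Fin d → ℝ} (hQ : Q ∈ openSimplex k) (hP : IsIProjection Q h α P)
    (hn : 0 < n) (S : Set (Fin n → Fin k)) :
    iidProb Q n (constraintEvent h α n ∩ S) =
      Real.exp (-(n * klDivergence P Q)) * iidProb P n (constraintEvent h α n ∩ S) := by
  classical
  rw [iidProb, iidProb, mul_sum]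
  refine sum_congr rfl fun x _ => ?_
  by_cases hx : x ∈ constraintEvent h α n ∩ S
  · rw [Set.indicator_of_mem hx, Set.indicator_of_mem hx,
      prod_eq_mul_prod_of_mem_constraintEvent hQ hP hn hx.1]
  · simp [Set.indicator_of_notMem hx]

/-- The factor `exp(-n D(P‖Q))` cancels between numerator and denominator, and with it all
dependence on `Q` beyond `P`. -/
theorem predictiveLaw_eq_sum_types {k d n m : ℕ} {Q P : Vec k} {h : Fin k → Fin d → ℝ}
    {α : Fin d → ℝ} (hQ : Q ∈ openSimplex k) (hP : IsIProjection Q h α P) (hn : 0 < n)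
    (hmn : m ≤ n) (A : Set (Fin m → Fin k)) :
    predictiveLaw Q h α hmn A =
      (∑ N ∈ types (tangentSpace h) P n, typeWeight P n N * withoutReplacementProb hmn N A) /
        ∑ N ∈ types (tangentSpace h) P n, typeWeight P n N := by
  have h2 := iidProb_eq_sum_types hP.1 hn hmn (Set.univ : Set (Fin m → Fin k))
  have h3 : constraintEvent h α n ∩ {x | (fun i => x (Fin.castLE hmn i)) ∈
      (Set.univ : Set (Fin m → Fin k))} = constraintEvent h α n := by simp
  rw [sum_congr rfl fun N hN => by rw [withoutReplacementProb_univ hmn N (mem_types.1 hN).1,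
    mul_one], h3] at h2
  have h4 := iidProb_constraintEvent_inter hQ hP hn Set.univ
  rw [Set.inter_univ, h2] at h4
  rw [predictiveLaw, iidProb_constraintEvent_inter hQ hP hn, iidProb_eq_sum_types hP.1 hn hmn, h4,
    mul_div_mul_left _ _ (Real.exp_pos _).ne']

/-! ### Independent draws: second moments and total variation -/

theorem sum_fin_succ_fun {m k : ℕ} {M : Type*} [AddCommMonoid M] (F : (Fin (m + 1) → Fin k) → M) :
    ∑ y, F y = ∑ a, ∑ z : Fin m → Fin k, F (Fin.cons a z) := by
  rw [← (Fin.consEquiv fun _ => Fin k).sum_comp, Fintype.sum_prod_type]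
  rfl

theorem sum_prod_iid {k : ℕ} {q : Fin k → ℝ} (hq : ∑ a, q a = 1) (m : ℕ) :
    ∑ y : Fin m → Fin k, ∏ i, q (y i) = 1 := by
  have := Finset.sum_pow' univ q m
  simpa [hq] using this.symm

theorem sum_prod_iid_mul_sum {k : ℕ} {q u : Fin k → ℝ} (hq : ∑ a, q a = 1)
    (hu : ∑ a, q a * u a = 0) (m : ℕ) :
    ∑ y : Fin m → Fin k, (∏ i, q (y i)) * ∑ i, u (y i) = 0 := by
  induction m with
  | zero => simp
  | succ m ih =>
    rw [sum_fin_succ_fun]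
    simp only [Fin.prod_univ_succ, Fin.sum_univ_succ, Fin.cons_zero, Fin.cons_succ]
    calc _ = ∑ a, (q a * u a * ∑ z : Fin m → Fin k, ∏ i, q (z i) +
          q a * ∑ z : Fin m → Fin k, (∏ i, q (z i)) * ∑ i, u (z i)) := by
          refine sum_congr rfl fun a _ => ?_
          rw [mul_sum, mul_sum, ← sum_add_distrib]
          exact sum_congr rfl fun z _ => by ring
      _ = 0 := by simp [ih, sum_prod_iid hq, hu]

theorem sum_prod_iid_mul_sum_sq {k : ℕ} {q u : Fin k → ℝ} (hq : ∑ a, q a = 1)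
    (hu : ∑ a, q a * u a = 0) (m : ℕ) :
    ∑ y : Fin m → Fin k, (∏ i, q (y i)) * (∑ i, u (y i)) ^ 2 = m * ∑ a, q a * u a ^ 2 := by
  induction m with
  | zero => simp
  | succ m ih =>
    rw [sum_fin_succ_fun]
    simp only [Fin.prod_univ_succ, Fin.sum_univ_succ, Fin.cons_zero, Fin.cons_succ]
    calc _ = ∑ a, (q a * u a ^ 2 * ∑ z : Fin m → Fin k, ∏ i, q (z i) +
          2 * q a * u a * ∑ z : Fin m → Fin k, (∏ i, q (z i)) * ∑ i, u (z i) +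
          q a * ∑ z : Fin m → Fin k, (∏ i, q (z i)) * (∑ i, u (z i)) ^ 2) := by
          refine sum_congr rfl fun a _ => ?_
          rw [mul_sum, mul_sum, mul_sum, ← sum_add_distrib, ← sum_add_distrib]
          exact sum_congr rfl fun z _ => by ring
      _ = _ := by
          simp only [ih, sum_prod_iid hq, sum_prod_iid_mul_sum hq hu, mul_one, mul_zero, add_zero,
            sum_add_distrib, ← sum_mul, hq]
          push_cast
          ring

/-- The expected chi-square statistic of `m` independent draws. -/
theorem sum_prod_iid_mul_chiSq_le {k : ℕ} {q : Fin k → ℝ} (hq : ∑ a, q a = 1)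
    (hpos : ∀ a, 0 < q a) (m : ℕ) :
    ∑ y : Fin m → Fin k, (∏ i, q (y i)) * ∑ a, (typeCount y a - m * q a) ^ 2 / q a ≤ m * k := by
  have h1 : ∀ a, ∑ y : Fin m → Fin k, (∏ i, q (y i)) * (typeCount y a - m * q a) ^ 2 =
      m * (q a * (1 - q a)) := by
    intro a
    have hu : ∑ b, q b * ((if b = a then 1 else 0) - q a) = 0 := by
      simp [mul_sub, sum_sub_distrib, ← sum_mul, hq]
    have h2 := sum_prod_iid_mul_sum_sq hq hu m
    have h3 : ∑ b, q b * ((if b = a then (1 : ℝ) else 0) - q a) ^ 2 = q a * (1 - q a) := by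
      have : ∀ b, q b * ((if b = a then (1 : ℝ) else 0) - q a) ^ 2 =
          (if b = a then q b * (1 - 2 * q a) else 0) + q b * q a ^ 2 := by
        intro b; split_ifs <;> ring
      simp only [this, sum_add_distrib, ← sum_mul, hq, sum_ite_eq', mem_univ, if_true]
      ring
    rw [h3] at h2
    rw [← h2]
    refine sum_congr rfl fun y _ => ?_
    rw [sum_sub_distrib, typeCount_eq_sum]
    simp
  calc _ = ∑ a, (∑ y : Fin m → Fin k, (∏ i, q (y i)) * (typeCount y a - m * q a) ^ 2) / q a := by
        simp only [mul_sum, sum_div]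
        rw [sum_comm]
        exact sum_congr rfl fun a _ => sum_congr rfl fun y _ => by ring
    _ ≤ ∑ _a : Fin k, (m : ℝ) := by
        refine sum_le_sum fun a _ => ?_
        rw [h1, div_le_iff₀ (hpos a)]
        have := hpos a
        have hm : (0 : ℝ) ≤ m := Nat.cast_nonneg m
        nlinarith [mul_nonneg hm (mul_nonneg this.le this.le)]
    _ = m * k := by simp [mul_comm]

/-- Replacing the factors one at a time costs one `ℓ¹` distance per draw. -/
theorem sum_abs_prod_iid_sub_le {k : ℕ} {q q' : Fin k → ℝ} (hq : ∑ a, q a = 1)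
    (hpos : ∀ a, 0 ≤ q a) (hq' : ∑ a, q' a = 1) (hpos' : ∀ a, 0 ≤ q' a) (m : ℕ) :
    ∑ y : Fin m → Fin k, |∏ i, q (y i) - ∏ i, q' (y i)| ≤ m * ∑ a, |q a - q' a| := by
  induction m with
  | zero => simp
  | succ m ih =>
    rw [sum_fin_succ_fun]
    simp only [Fin.prod_univ_succ, Fin.cons_zero, Fin.cons_succ]
    calc _ ≤ ∑ a, (|q a - q' a| * ∑ z : Fin m → Fin k, ∏ i, q (z i) +
          q' a * ∑ z : Fin m → Fin k, |∏ i, q (z i) - ∏ i, q' (z i)|) := by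
          refine sum_le_sum fun a _ => ?_
          rw [mul_sum, mul_sum, ← sum_add_distrib]
          refine sum_le_sum fun z _ => ?_
          have e : q a * ∏ i, q (z i) - q' a * ∏ i, q' (z i) =
              (q a - q' a) * ∏ i, q (z i) + q' a * (∏ i, q (z i) - ∏ i, q' (z i)) := by ring
          rw [e]
          refine (abs_add_le _ _).trans (le_of_eq ?_)
          rw [abs_mul, abs_mul, abs_of_nonneg (hpos' a),
            abs_of_nonneg (prod_nonneg fun i _ => hpos (z i))]
      _ = ∑ a, |q a - q' a| + ∑ z : Fin m → Fin k, |∏ i, q (z i) - ∏ i, q' (z i)| := by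
          simp [sum_add_distrib, sum_prod_iid hq, ← sum_mul, hq']
      _ ≤ _ := by
          push_cast
          linarith

theorem abs_iidProb_sub_le {k : ℕ} {P P' : Vec k} (hP : ∑ a, P a = 1)
    (hpos : ∀ a, 0 ≤ P a) (hP' : ∑ a, P' a = 1) (hpos' : ∀ a, 0 ≤ P' a) (m : ℕ)
    (A : Set (Fin m → Fin k)) :
    |iidProb P m A - iidProb P' m A| ≤ m * ∑ a, |P a - P' a| := by
  classical
  refine le_trans ?_ (sum_abs_prod_iid_sub_le hP hpos hP' hpos' m)
  rw [iidProb, iidProb, ← sum_sub_distrib]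
  refine (abs_sum_le_sum_abs _ _).trans (sum_le_sum fun y _ => ?_)
  by_cases hy : y ∈ A <;> simp [hy]

theorem iidProb_nonneg {k : ℕ} {P : Vec k} (hpos : ∀ a, 0 ≤ P a) (m : ℕ)
    (A : Set (Fin m → Fin k)) : 0 ≤ iidProb P m A :=
  sum_nonneg fun y _ =>
    Set.indicator_nonneg (fun z _ => prod_nonneg fun i _ => hpos (z i)) y

theorem iidProb_le_one {k : ℕ} {P : Vec k} (hP : ∑ a, P a = 1) (hpos : ∀ a, 0 ≤ P a) (m : ℕ)
    (A : Set (Fin m → Fin k)) : iidProb P m A ≤ 1 := by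
  rw [← sum_prod_iid hP m]
  exact sum_le_sum fun y _ =>
    Set.indicator_le_self' (f := fun y => ∏ i, P (y i))
      (fun z _ => prod_nonneg fun i _ => hpos (z i)) y

/-! ### Draws without replacement against independent draws -/

theorem exp_neg_sub_two_mul_sq_le {x : ℝ} (h1 : x ≤ 1 / 2) :
    Real.exp (-(x + 2 * x ^ 2)) ≤ 1 - x := by
  rw [Real.exp_neg, inv_le_iff_one_le_mul₀ (Real.exp_pos _)]
  have := Real.add_one_le_exp (x + 2 * x ^ 2)
  have h2 : 0 ≤ 1 - x := by linarith
  -- The product equals `1 + x² (1 - 2x)`.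
  calc (1 : ℝ) ≤ (1 - x) * (x + 2 * x ^ 2 + 1) := by nlinarith [sq_nonneg x]
    _ ≤ _ := mul_le_mul_of_nonneg_left this h2

/-- Each factor `N (1 - i/N)` is at least `N exp(-(i/N + 2 (i/N)²))`, and over `i < c` one has `∑ i
≤ c²/2`, `∑ i² ≤ c³`. A lower bound suffices for these numerators, since `abs_sum_indicator_sub_le`
needs a one-sided comparison only. -/
theorem pow_mul_exp_le_descFactorial {N c : ℕ} (hN : 0 < N) (hc : 2 * c ≤ N) :
    (N : ℝ) ^ c * Real.exp (-((c : ℝ) ^ 2 / (2 * N) + 2 * (c : ℝ) ^ 3 / N ^ 2)) ≤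
      N.descFactorial c := by
  have hN' : (0 : ℝ) < N := by exact_mod_cast hN
  induction c with
  | zero => simp
  | succ c ih =>
    have ih := ih (by omega)
    have hx : (c : ℝ) / N ≤ 1 / 2 := by
      rw [div_le_div_iff₀ hN' two_pos]
      have : ((2 * (c + 1) : ℕ) : ℝ) ≤ N := by exact_mod_cast hc
      push_cast at this
      linarith
    have h1 := exp_neg_sub_two_mul_sq_le hx
    have hcN : c ≤ N := by omega
    rw [Nat.descFactorial_succ, Nat.cast_mul, Nat.cast_sub hcN]
    have h2 : (N : ℝ) - c = N * (1 - c / N) := by field_simp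
    rw [h2]
    have h3 : Real.exp (-(((c + 1 : ℕ) : ℝ) ^ 2 / (2 * N) + 2 * ((c + 1 : ℕ) : ℝ) ^ 3 / N ^ 2)) ≤
        Real.exp (-((c : ℝ) ^ 2 / (2 * N) + 2 * (c : ℝ) ^ 3 / N ^ 2)) *
          Real.exp (-((c : ℝ) / N + 2 * ((c : ℝ) / N) ^ 2)) := by
      rw [← Real.exp_add, Real.exp_le_exp]
      have e : -(((c + 1 : ℕ) : ℝ) ^ 2 / (2 * N) + 2 * ((c + 1 : ℕ) : ℝ) ^ 3 / N ^ 2) =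
          -((c : ℝ) ^ 2 / (2 * N) + 2 * (c : ℝ) ^ 3 / N ^ 2) +
          -((c : ℝ) / N + 2 * ((c : ℝ) / N) ^ 2) -
          (1 / (2 * N) + 2 * (2 * (c : ℝ) ^ 2 + 3 * c + 1) / N ^ 2) := by
        push_cast
        field_simp
        ring
      rw [e]
      have : 0 ≤ (1 / (2 * N) + 2 * (2 * (c : ℝ) ^ 2 + 3 * c + 1) / N ^ 2) := by positivity
      linarith
    calc _ ≤ (N : ℝ) ^ (c + 1) * (Real.exp (-((c : ℝ) ^ 2 / (2 * N) + 2 * (c : ℝ) ^ 3 / N ^ 2)) *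
          Real.exp (-((c : ℝ) / N + 2 * ((c : ℝ) / N) ^ 2))) := by gcongr
      _ = (N * Real.exp (-((c : ℝ) / N + 2 * ((c : ℝ) / N) ^ 2))) *
          ((N : ℝ) ^ c * Real.exp (-((c : ℝ) ^ 2 / (2 * N) + 2 * (c : ℝ) ^ 3 / N ^ 2))) := by ring
      _ ≤ _ := by
        refine mul_le_mul (by gcongr) ih (by positivity) ?_
        exact mul_nonneg hN'.le (by linarith)

/-- From `1 - x ≤ exp(-x)`. The exact sum `∑_{i<m} i = (m² - m)/2` is kept, because its `m²` has to
cancel later. -/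
theorem descFactorial_le_pow_mul_exp {n m : ℕ} (hn : 0 < n) (hm : m ≤ n) :
    (n.descFactorial m : ℝ) ≤ (n : ℝ) ^ m * Real.exp (-(((m : ℝ) ^ 2 - m) / (2 * n))) := by
  have hn' : (0 : ℝ) < n := by exact_mod_cast hn
  induction m with
  | zero => simp
  | succ m ih =>
    have ih := ih (by omega)
    rw [Nat.descFactorial_succ, Nat.cast_mul, Nat.cast_sub (by omega)]
    have h2 : (n : ℝ) - m = n * (-(m / n) + 1) := by field_simp; ring
    have h3 := Real.add_one_le_exp (-((m : ℝ) / n))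
    have e : -((((m + 1 : ℕ) : ℝ) ^ 2 - ((m + 1 : ℕ) : ℝ)) / (2 * n)) =
        -((m : ℝ) / n) + -(((m : ℝ) ^ 2 - m) / (2 * n)) := by
      push_cast
      field_simp
      ring
    rw [h2, e, Real.exp_add]
    calc _ ≤ (n * Real.exp (-((m : ℝ) / n))) *
          ((n : ℝ) ^ m * Real.exp (-(((m : ℝ) ^ 2 - m) / (2 * n)))) := by gcongr
      _ = _ := by ring

/-- Two probability vectors are close on every event if one of them is nowhere much smaller than
the other. -/
theorem abs_sum_indicator_sub_le {ι : Type*} [Fintype ι] {μ ν B : ι → ℝ} (hμ : ∑ y, μ y = 1)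
    (hν : ∑ y, ν y = 1) (hB : ∀ y, 0 ≤ ν y * B y) (h : ∀ y, ν y * (1 - B y) ≤ μ y) (A : Set ι) :
    |∑ y, A.indicator μ y - ∑ y, A.indicator ν y| ≤ ∑ y, ν y * B y := by
  classical
  have key : ∀ A : Set ι, ∑ y, A.indicator ν y - ∑ y, A.indicator μ y ≤ ∑ y, ν y * B y := by
    intro A
    rw [← sum_sub_distrib]
    refine sum_le_sum fun y _ => ?_
    by_cases hy : y ∈ A
    · simp only [hy, Set.indicator_of_mem]
      linarith [h y]
    · simpa [hy] using hB y
  -- Both total masses are one, so the bound for the complement is the opposite inequality for `A`.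
  have hc : ∀ f : ι → ℝ, ∑ y, Aᶜ.indicator f y = ∑ y, f y - ∑ y, A.indicator f y := by
    intro f
    rw [← sum_sub_distrib]
    refine sum_congr rfl fun y _ => ?_
    by_cases hy : y ∈ A <;> simp [hy]
  rw [abs_le]
  have h1 := key A
  have h2 := key Aᶜ
  rw [hc, hc, hμ, hν] at h2
  constructor <;> linarith

/-- Draws without replacement from a large population are close to independent draws. -/
theorem abs_withoutReplacementProb_sub_iidProb_le {k n m : ℕ} (hmn : m ≤ n) {N : Fin k → ℕ}
    (hN : ∑ a, N a = n) (hn : 0 < n) {p : ℝ} (hp : 0 < p) (hpN : ∀ a, p * n ≤ N a)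
    (hm : (m : ℝ) ^ 2 ≤ n) (hmp : 2 * m ≤ p * n) (A : Set (Fin m → Fin k)) :
    |withoutReplacementProb hmn N A - iidProb (WithLp.toLp 2 fun a => (N a : ℝ) / n) m A| ≤
      (k + 1 + 2 / p ^ 2) * (m / n) := by
  have hn' : (0 : ℝ) < n := by exact_mod_cast hn
  have hNpos : ∀ a, (0 : ℝ) < N a := fun a => lt_of_lt_of_le (by positivity) (hpN a)
  have h2N : ∀ a, 2 * m ≤ N a := fun a => by exact_mod_cast hmp.trans (hpN a)
  set q : Fin k → ℝ := fun a => (N a : ℝ) / n with hqdef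
  have hqpos : ∀ a, 0 < q a := fun a => div_pos (hNpos a) hn'
  have hq1 : ∑ a, q a = 1 := by
    rw [hqdef, ← sum_div, ← Nat.cast_sum, hN, div_self hn'.ne']
  set μ : (Fin m → Fin k) → ℝ := fun y => withoutReplacementProb hmn N {y}
  set ν : (Fin m → Fin k) → ℝ := fun y => ∏ i, q (y i)
  -- `B` bounds the loss in the exponent. Writing `N_a = n q_a`, the quadratic terms `∑ c_a²/(2
  -- N_a)` equal `(χ² + m²)/(2n)`, and the denominator gives back `(m² - m)/(2n)`, so only `χ²/(2n)
  -- + m/(2n)` survives. The cubic terms are at most `(2/p²) m/n` because `c_a² ≤ m² ≤ n`.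
  set B : (Fin m → Fin k) → ℝ := fun y =>
    (1 / (2 * n)) * ∑ a, (typeCount y a - m * q a) ^ 2 / q a + (1 + 2 / p ^ 2) * (m / n)
  have hν0 : ∀ y, 0 ≤ ν y := fun y => prod_nonneg fun i _ => (hqpos _).le
  have hB0 : ∀ y, 0 ≤ B y := fun y => by
    have : 0 ≤ ∑ a, (typeCount y a - m * q a) ^ 2 / q a :=
      sum_nonneg fun a _ => div_nonneg (sq_nonneg _) (hqpos a).le
    positivity
  have hμ1 : ∑ y, μ y = 1 := by
    have := withoutReplacementProb_eq_sum hmn N Set.univ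
    rw [withoutReplacementProb_univ hmn N hN] at this
    simpa using this.symm
  have hν1 : ∑ y, ν y = 1 := sum_prod_iid hq1 m
  have hpt : ∀ y, ν y * (1 - B y) ≤ μ y := by
    intro y
    have hcm : ∀ a, typeCount y a ≤ m := typeCount_le y
    have hle : typeCount y ≤ N := fun a => by
      have := hcm a; have := h2N a; show typeCount y a ≤ N a; omega
    have hμy : μ y = (∏ a, ((N a).descFactorial (typeCount y a) : ℝ)) / n.descFactorial m :=
      withoutReplacementProb_singleton hmn N hN y hle
    have hνy : ν y = (∏ a, (N a : ℝ) ^ typeCount y a) / n ^ m := by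
      rw [show ν y = ∏ i, q (y i) from rfl, prod_comp_eq_prod_pow y q]
      simp only [hqdef, div_pow, prod_div_distrib]
      rw [prod_pow_eq_pow_sum, sum_typeCount]
    have hd : (0 : ℝ) < n.descFactorial m := by exact_mod_cast Nat.descFactorial_pos.2 hmn
    set S : ℝ := ∑ a, ((typeCount y a : ℝ) ^ 2 / (2 * N a) + 2 * (typeCount y a : ℝ) ^ 3 / N a ^ 2)
    set D : ℝ := ((m : ℝ) ^ 2 - m) / (2 * n)
    have h1 : (∏ a, (N a : ℝ) ^ typeCount y a) * Real.exp (-S) ≤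
        ∏ a, ((N a).descFactorial (typeCount y a) : ℝ) := by
      rw [← sum_neg_distrib, Real.exp_sum, ← prod_mul_distrib]
      refine prod_le_prod (fun a _ => by positivity) fun a _ => ?_
      refine pow_mul_exp_le_descFactorial (by exact_mod_cast hNpos a) ?_
      have := hcm a; have := h2N a; omega
    have h2 : (n.descFactorial m : ℝ) ≤ (n : ℝ) ^ m * Real.exp (-D) :=
      descFactorial_le_pow_mul_exp hn hmn
    have h3 : ν y * Real.exp (D - S) ≤ μ y := by
      rw [hμy, hνy, le_div_iff₀ hd]
      calc _ ≤ (∏ a, (N a : ℝ) ^ typeCount y a) / n ^ m * Real.exp (D - S) *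
            ((n : ℝ) ^ m * Real.exp (-D)) := by gcongr
        _ = (∏ a, (N a : ℝ) ^ typeCount y a) * (Real.exp (D - S) * Real.exp (-D)) := by
            field_simp
        _ = (∏ a, (N a : ℝ) ^ typeCount y a) * Real.exp (-S) := by
            rw [← Real.exp_add]; congr 2; ring
        _ ≤ _ := h1
    refine le_trans (mul_le_mul_of_nonneg_left ?_ (hν0 y)) h3
    have h4 := Real.add_one_le_exp (D - S)
    suffices S - D ≤ B y by linarith
    have hsumc : ∑ a, (typeCount y a : ℝ) = m := by exact_mod_cast sum_typeCount y
    have hchi : ∑ a, (typeCount y a - m * q a) ^ 2 / q a =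
        ∑ a, (typeCount y a : ℝ) ^ 2 / q a - m ^ 2 := by
      have : ∀ a, (typeCount y a - m * q a) ^ 2 / q a =
          (typeCount y a : ℝ) ^ 2 / q a - 2 * m * typeCount y a + m ^ 2 * q a := by
        intro a
        have := (hqpos a).ne'
        field_simp
        ring
      simp only [this, sum_add_distrib, sum_sub_distrib, ← mul_sum, hsumc, hq1]
      ring
    have hS : S ≤ (1 / (2 * n)) * ∑ a, (typeCount y a : ℝ) ^ 2 / q a + 2 / p ^ 2 * (m / n) := by
      have e : 2 / p ^ 2 * ((m : ℝ) / n) = ∑ a, 2 / p ^ 2 * ((typeCount y a : ℝ) / n) := by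
        rw [← mul_sum, ← sum_div, hsumc]
      rw [e, mul_sum, ← sum_add_distrib]
      refine sum_le_sum fun a _ => ?_
      have e1 : (typeCount y a : ℝ) ^ 2 / (2 * N a) =
          1 / (2 * n) * ((typeCount y a : ℝ) ^ 2 / q a) := by
        have := hNpos a
        simp only [hqdef]
        field_simp
      rw [e1]
      gcongr
      have hc : (typeCount y a : ℝ) ≤ m := by exact_mod_cast hcm a
      have hc2 : (typeCount y a : ℝ) ^ 3 ≤ typeCount y a * n := by
        have : (typeCount y a : ℝ) ^ 2 ≤ n := le_trans (by gcongr) hm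
        calc (typeCount y a : ℝ) ^ 3 = typeCount y a * (typeCount y a : ℝ) ^ 2 := by ring
          _ ≤ _ := by gcongr
      calc 2 * (typeCount y a : ℝ) ^ 3 / N a ^ 2
          ≤ 2 * (typeCount y a * n) / (p * n) ^ 2 := by gcongr; exact hpN a
        _ = _ := by field_simp
    have hD : D = (1 / (2 * n)) * m ^ 2 - m / n / 2 := by
      simp only [D]; field_simp
    have hmn0 : (0 : ℝ) ≤ m / n := by positivity
    simp only [B]
    rw [hchi, hD]
    nlinarith [hS]
  have := abs_sum_indicator_sub_le hμ1 hν1 (fun y => mul_nonneg (hν0 y) (hB0 y)) hpt A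
  rw [← withoutReplacementProb_eq_sum] at this
  refine (this.trans ?_)
  have hchi := sum_prod_iid_mul_chiSq_le hq1 hqpos m
  calc ∑ y, ν y * B y = 1 / (2 * n) *
        ∑ y : Fin m → Fin k, (∏ i, q (y i)) * ∑ a, (typeCount y a - m * q a) ^ 2 / q a +
        (∑ y, ν y) * ((1 + 2 / p ^ 2) * (m / n)) := by
        rw [mul_sum, sum_mul, ← sum_add_distrib]
        refine sum_congr rfl fun y _ => ?_
        simp only [B, ν]
        ring
    _ ≤ 1 / (2 * n) * (m * k) + 1 * ((1 + 2 / p ^ 2) * (m / n)) := by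
        rw [hν1]; gcongr
    _ = (k / 2 + 1 + 2 / p ^ 2) * (m / n) := by field_simp; ring
    _ ≤ _ := by
        have : (0 : ℝ) ≤ k := Nat.cast_nonneg k
        gcongr
        linarith

/-! ### Stirling's formula and the weights of types -/

theorem log_stirlingSeq_le {N : ℕ} (hN : 0 < N) :
    Real.log (Stirling.stirlingSeq N) ≤ Real.log √Real.pi + 1 / (2 * N) := by
  -- Successive logarithms drop by at most `1/(12 j (j+1))`, which is less than the drop of
  -- `1/(2j)`; the corrected sequence increases to its limit `log √π`.
  have hmono : Monotone fun j : ℕ =>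
      Real.log (Stirling.stirlingSeq (j + 1)) - 1 / (2 * ((j + 1 : ℕ) : ℝ)) := by
    refine monotone_nat_of_le_succ fun j => ?_
    have h := Stirling.log_stirlingSeq_sdiff_le (j + 1)
    have h2 : 1 / (12 * ((j + 1 : ℕ) : ℝ) * (((j + 1 : ℕ) : ℝ) + 1)) ≤
        1 / (2 * ((j + 1 : ℕ) : ℝ)) - 1 / (2 * ((j + 1 + 1 : ℕ) : ℝ)) := by
      have hj : (0 : ℝ) ≤ j := Nat.cast_nonneg j
      push_cast
      rw [div_sub_div _ _ (by positivity) (by positivity), div_le_div_iff₀ (by positivity)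
        (by positivity)]
      nlinarith [mul_nonneg hj hj, mul_nonneg hj (mul_nonneg hj hj)]
    push_cast at h h2 ⊢
    linarith
  have hlim : Filter.Tendsto (fun j : ℕ =>
      Real.log (Stirling.stirlingSeq (j + 1)) - 1 / (2 * ((j + 1 : ℕ) : ℝ))) Filter.atTop
      (nhds (Real.log √Real.pi - 0)) := by
    refine Filter.Tendsto.sub ?_ ?_
    · exact ((Filter.tendsto_add_atTop_iff_nat 1).2 Stirling.tendsto_stirlingSeq_sqrt_pi).log
        (Real.sqrt_pos.2 Real.pi_pos).ne'
    · have h := (tendsto_one_div_add_atTop_nhds_zero_nat (𝕜 := ℝ)).mul_const (1 / 2)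
      rw [zero_mul] at h
      refine h.congr fun j => ?_
      push_cast
      field_simp
  have := hmono.ge_of_tendsto hlim (N - 1)
  simp only [Nat.sub_add_cancel hN] at this
  linarith

theorem log_sqrt_pi_le_log_stirlingSeq {N : ℕ} (hN : 0 < N) :
    Real.log √Real.pi ≤ Real.log (Stirling.stirlingSeq N) :=
  Real.log_le_log (Real.sqrt_pos.2 Real.pi_pos) (Stirling.sqrt_pi_le_stirlingSeq hN.ne')

theorem abs_log_one_add_le {t : ℝ} (ht : |t| ≤ 1 / 2) : |Real.log (1 + t)| ≤ 2 * |t| := by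
  have h := Real.abs_log_sub_add_sum_range_le (x := -t) (by rw [abs_neg]; linarith) 0
  simp only [range_zero, sum_empty, zero_add, sub_neg_eq_add, abs_neg, pow_one] at h
  refine h.trans ?_
  rw [div_le_iff₀ (by linarith)]
  nlinarith [abs_nonneg t]

theorem abs_one_add_mul_log_sub_le {t : ℝ} (ht : |t| ≤ 1 / 2) :
    |(1 + t) * Real.log (1 + t) - t - t ^ 2 / 2| ≤ 4 * |t| ^ 3 := by
  have h := Real.abs_log_sub_add_sum_range_le (x := -t) (by rw [abs_neg]; linarith) 2
  simp only [sum_range_succ, range_zero, sum_empty, zero_add, sub_neg_eq_add, abs_neg] at h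
  norm_num at h
  set e := -t + t ^ 2 / 2 + Real.log (1 + t) with he
  have h1 : |e| ≤ 2 * |t| ^ 3 := by
    refine h.trans ?_
    rw [div_le_iff₀ (by linarith)]
    nlinarith [pow_nonneg (abs_nonneg t) 3]
  have h2 : (1 + t) * Real.log (1 + t) - t - t ^ 2 / 2 = (1 + t) * e - t ^ 3 / 2 := by
    rw [he]; ring
  have h3 : |1 + t| ≤ 3 / 2 := by
    refine (abs_add_le _ _).trans ?_
    rw [abs_one]; linarith
  rw [h2]
  refine (abs_sub _ _).trans ?_
  rw [abs_mul, abs_div, abs_pow, abs_of_pos (two_pos (α := ℝ))]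
  have := mul_le_mul h3 h1 (abs_nonneg _) (by norm_num)
  nlinarith [pow_nonneg (abs_nonneg t) 3]

/-- The left side of the entropy bound dominates the Hellinger square `(√x - 1)²`, and `(x - 1)² =
(√x - 1)² (√x + 1)²` with `p (√x + 1)² ≤ 2 (p x + p) ≤ 4`. It is applied with `x = N_a/(n P_a)`, far
from `1` as well as near it. -/
theorem mul_sq_le_mul_log_sub {x p : ℝ} (hx : 0 < x) (hp1 : p ≤ 1)
    (hpx : p * x ≤ 1) : p / 4 * (x - 1) ^ 2 ≤ x * Real.log x - (x - 1) := by
  set s := √x with hs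
  have hs0 : 0 < s := Real.sqrt_pos.2 hx
  have hxs : x = s ^ 2 := (Real.sq_sqrt hx.le).symm
  have h1 : 1 - s⁻¹ ≤ Real.log s := Real.one_sub_inv_le_log_of_pos hs0
  have h2 : Real.log x = 2 * Real.log s := by rw [hxs, Real.log_pow]; norm_num
  have h3 : (s - 1) ^ 2 ≤ x * Real.log x - (x - 1) := by
    rw [h2]
    have : s ^ 2 * (1 - s⁻¹) ≤ s ^ 2 * Real.log s := by gcongr
    have e : s ^ 2 * (1 - s⁻¹) = s ^ 2 - s := by field_simp
    rw [e] at this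
    rw [hxs]
    nlinarith
  refine le_trans ?_ h3
  have h4 : (x - 1) ^ 2 = (s - 1) ^ 2 * (s + 1) ^ 2 := by rw [hxs]; ring
  rw [h4]
  have h5 : p * (s + 1) ^ 2 ≤ 4 := by
    have : (s + 1) ^ 2 ≤ 2 * (x + 1) := by rw [hxs]; nlinarith [sq_nonneg (s - 1)]
    nlinarith
  nlinarith [sq_nonneg (s - 1), mul_nonneg (sq_nonneg (s - 1)) (sub_nonneg.2 h5)]

/-- The logarithm of the weight of a central type, by Stirling's formula. -/
def logNorm {k : ℕ} (P : Vec k) (n : ℕ) : ℝ :=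
  Real.log n.factorial - n * (Real.log n - 1) -
    ∑ a, (Real.log √Real.pi + 1 / 2 * Real.log (2 * (n * P a)))

theorem typeWeight_pos {k n : ℕ} {P : Vec k} (hP : ∀ a, 0 < P a) {N : Fin k → ℕ}
    (hN : ∑ a, N a = n) : 0 < typeWeight P n N := by
  have := card_pos.2 (typeClass_nonempty hN)
  have := prod_pos fun a (_ : a ∈ univ) => pow_pos (hP a) (N a)
  unfold typeWeight
  positivity

/-- An exact identity, used for both the global and the local estimate. Everything independent of
`N` is collected in `logNorm`. The linear terms `N_a - n P_a` sum to zero, and subtracting them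
makes each entropy term vanish to second order at `N_a = n P_a`. -/
theorem log_typeWeight {k n : ℕ} (hn : 0 < n) {P : Vec k} (hP : ∀ a, 0 < P a)
    (hP1 : ∑ a, P a = 1) {N : Fin k → ℕ} (hN : ∑ a, N a = n) (hpos : ∀ a, 0 < N a) :
    Real.log (typeWeight P n N) = logNorm P n -
      ∑ a, ((Real.log (Stirling.stirlingSeq (N a)) - Real.log √Real.pi) +
        1 / 2 * Real.log (N a / (n * P a)) +
        (N a * Real.log (N a / (n * P a)) - (N a - n * P a))) := by
  have hn' : (0 : ℝ) < n := by exact_mod_cast hn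
  have hpos' : ∀ a, (0 : ℝ) < N a := fun a => by exact_mod_cast hpos a
  have hNr : ∑ a, (N a : ℝ) = n := by exact_mod_cast hN
  have h1 : (typeClass n N).card * ∏ a, ((N a).factorial : ℝ) = n.factorial := by
    exact_mod_cast card_typeClass_mul n N hN
  have hF : (∏ a, ((N a).factorial : ℝ)) ≠ 0 :=
    prod_ne_zero_iff.2 fun a _ => by exact_mod_cast (Nat.factorial_ne_zero _)
  have hc : ((typeClass n N).card : ℝ) ≠ 0 := by
    exact_mod_cast (card_pos.2 (typeClass_nonempty hN)).ne'
  have h2 : Real.log (typeClass n N).card =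
      Real.log n.factorial - ∑ a, Real.log (N a).factorial := by
    rw [← h1, Real.log_mul hc hF, Real.log_prod fun a _ => by
      exact_mod_cast (Nat.factorial_ne_zero _)]
    ring
  have hPp : (∏ a, P a ^ N a) ≠ 0 := prod_ne_zero_iff.2 fun a _ => pow_ne_zero _ (hP a).ne'
  rw [typeWeight, Real.log_mul hc hPp, h2, Real.log_prod fun a _ => pow_ne_zero _ (hP a).ne',
    logNorm]
  have e0 : (n : ℝ) * (Real.log n - 1) = ∑ a, (N a : ℝ) * (Real.log n - 1) := by
    rw [← sum_mul, hNr]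
  have e1 : ∑ a, ((N a : ℝ) - n * P a) = 0 := by
    rw [sum_sub_distrib, hNr, ← mul_sum, hP1]; ring
  have key : ∀ a, Real.log (N a).factorial = Real.log (P a ^ N a) + (N a : ℝ) * (Real.log n - 1) +
      (Real.log √Real.pi + 1 / 2 * Real.log (2 * (n * P a))) +
      ((Real.log (Stirling.stirlingSeq (N a)) - Real.log √Real.pi) +
        1 / 2 * Real.log (N a / (n * P a)) +
        (N a * Real.log (N a / (n * P a)) - (N a - n * P a))) + ((N a : ℝ) - n * P a) := by
    intro a
    have h := Stirling.log_stirlingSeq_formula (N a)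
    have hpa := (hP a).ne'
    have hna := (hpos' a).ne'
    rw [Real.log_div hna (mul_ne_zero hn'.ne' hpa), Real.log_mul two_ne_zero
      (mul_ne_zero hn'.ne' hpa), Real.log_mul hn'.ne' hpa, Real.log_pow]
    rw [Real.log_mul two_ne_zero hna, Real.log_div hna (Real.exp_pos 1).ne', Real.log_exp] at h
    rw [h]
    ring
  simp only [key]
  simp only [sum_add_distrib, e1]
  simp only [← e0]
  ring

/-- The tail bound, valid for all types with positive counts. Since `N_a ≥ 1` and `P_a ≤ 1`, the
square-root correction costs at most `½ log n` per letter; this polynomial loss is harmless against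
the Gaussian factor. -/
theorem typeWeight_le {k n : ℕ} (hn : 0 < n) {P : Vec k} {p : ℝ} (hp : 0 < p)
    (hpP : ∀ a, p ≤ P a) (hP1 : ∑ a, P a = 1) {N : Fin k → ℕ} (hN : ∑ a, N a = n)
    (hpos : ∀ a, 0 < N a) :
    typeWeight P n N ≤ Real.exp (logNorm P n) *
      Real.exp (k / 2 * Real.log n - p / 4 * (∑ a, (N a - n * P a) ^ 2 / n)) := by
  have hn' : (0 : ℝ) < n := by exact_mod_cast hn
  have hP : ∀ a, 0 < P a := fun a => hp.trans_le (hpP a)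
  have hPle : ∀ a, P a ≤ 1 := fun a => by
    rw [← hP1]
    exact single_le_sum (f := fun a => P a) (fun b _ => (hP b).le) (mem_univ a)
  have hpos' : ∀ a, (1 : ℝ) ≤ N a := fun a => by exact_mod_cast hpos a
  have hNle : ∀ a, (N a : ℝ) ≤ n := fun a => by
    rw [← hN]
    exact_mod_cast single_le_sum (f := N) (fun b _ => Nat.zero_le _) (mem_univ a)
  rw [← Real.exp_add, ← Real.log_le_iff_le_exp (typeWeight_pos hP hN),
    log_typeWeight hn hP hP1 hN hpos]
  have : ∑ a : Fin k, (-(1 / 2 * Real.log n) + p / 4 * ((N a - n * P a) ^ 2 / n)) ≤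
      ∑ a, ((Real.log (Stirling.stirlingSeq (N a)) - Real.log √Real.pi) +
        1 / 2 * Real.log (N a / (n * P a)) +
        (N a * Real.log (N a / (n * P a)) - (N a - n * P a))) := by
    refine sum_le_sum fun a _ => ?_
    have h1 := log_sqrt_pi_le_log_stirlingSeq (hpos a)
    have hnP : 0 < n * P a := mul_pos hn' (hP a)
    have hx : 0 < (N a : ℝ) / (n * P a) := div_pos (by linarith [hpos' a]) hnP
    have h2 : -Real.log n ≤ Real.log (N a / (n * P a)) := by
      rw [← Real.log_inv]
      refine Real.log_le_log (by positivity) ?_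
      rw [le_div_iff₀ hnP, ← mul_assoc, inv_mul_cancel₀ hn'.ne', one_mul]
      linarith [hPle a, hpos' a]
    have h3 := mul_sq_le_mul_log_sub hx ((hpP a).trans (hPle a)) (by
      rw [← mul_div_assoc, div_le_one hnP, mul_comm (n : ℝ)]
      exact mul_le_mul (hpP a) (hNle a) (by linarith [hpos' a]) (hP a).le)
    have h4 : p / 4 * ((N a - n * P a) ^ 2 / n) ≤
        (n * P a) * (p / 4 * ((N a : ℝ) / (n * P a) - 1) ^ 2) := by
      have e : (n * P a) * (p / 4 * ((N a : ℝ) / (n * P a) - 1) ^ 2) =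
          p / 4 * ((N a - n * P a) ^ 2 / (n * P a)) := by
        have := (hP a).ne'
        field_simp
      rw [e]
      gcongr
      exact mul_le_of_le_one_right hn'.le (hPle a)
    have h5 : (n * P a) * ((N a : ℝ) / (n * P a) * Real.log (N a / (n * P a)) -
        ((N a : ℝ) / (n * P a) - 1)) =
        N a * Real.log (N a / (n * P a)) - (N a - n * P a) := by
      have := (hP a).ne'
      field_simp
    have h6 := mul_le_mul_of_nonneg_left h3 hnP.le
    rw [h5] at h6
    linarith
  rw [sum_add_distrib, ← mul_sum, sum_const, card_univ, Fintype.card_fin, nsmul_eq_mul] at this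
  linarith

/-- Expansion in `t = N_a/(n P_a) - 1`, with `|t| ≤ B/(n p) ≤ 1/2`. The three errors come from the
Stirling remainder, the square-root correction and the cubic Taylor remainder of the entropy. -/
theorem abs_log_typeWeight_sub_le {k n : ℕ} (hn : 0 < n) {P : Vec k} {p : ℝ} (hp : 0 < p)
    (hpP : ∀ a, p ≤ P a) (hP1 : ∑ a, P a = 1) {N : Fin k → ℕ} (hN : ∑ a, N a = n)
    {B : ℝ} (hB : ∀ a, |(N a : ℝ) - n * P a| ≤ B) (hBn : 2 * B ≤ p * n) :
    |Real.log (typeWeight P n N) -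
      (logNorm P n - 1 / 2 * ∑ a, (N a - n * P a) ^ 2 / (n * P a))| ≤
      k * (1 / (n * p) + B / (n * p) + 4 * B ^ 3 / (n * p) ^ 2) := by
  have hn' : (0 : ℝ) < n := by exact_mod_cast hn
  have hP : ∀ a, 0 < P a := fun a => hp.trans_le (hpP a)
  have hnp : ∀ a, n * p ≤ n * P a := fun a => by gcongr; exact hpP a
  have hNbig : ∀ a, n * p / 2 ≤ N a := fun a => by
    have := (abs_le.1 (hB a)).1
    have := hnp a
    linarith
  have hpos' : ∀ a, (0 : ℝ) < N a := fun a => lt_of_lt_of_le (by positivity) (hNbig a)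
  have hpos : ∀ a, 0 < N a := fun a => by exact_mod_cast hpos' a
  rw [log_typeWeight hn hP hP1 hN hpos]
  have e : ∀ x y z : ℝ, x - y - (x - z) = -(y - z) := fun x y z => by ring
  rw [e, abs_neg, mul_sum, ← sum_sub_distrib]
  refine (abs_sum_le_sum_abs _ _).trans ?_
  have : (k : ℝ) * (1 / (n * p) + B / (n * p) + 4 * B ^ 3 / (n * p) ^ 2) =
      ∑ _a : Fin k, (1 / (n * p) + B / (n * p) + 4 * B ^ 3 / (n * p) ^ 2) := by
    rw [sum_const, card_univ, Fintype.card_fin, nsmul_eq_mul]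
  rw [this]
  refine sum_le_sum fun a _ => ?_
  have hnP : 0 < n * P a := mul_pos hn' (hP a)
  have hnp0 : 0 < n * p := mul_pos hn' hp
  have hB0 : 0 ≤ B := (abs_nonneg _).trans (hB a)
  have hPa := (hP a).ne'
  set t : ℝ := (N a - n * P a) / (n * P a) with ht
  have ht1 : (N a : ℝ) / (n * P a) = 1 + t := by rw [ht]; field_simp; ring
  have hNt : (N a : ℝ) - n * P a = n * P a * t := by rw [ht]; field_simp
  have hNt' : (N a : ℝ) = n * P a * (1 + t) := by linarith
  have htB : |t| ≤ B / (n * p) := by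
    rw [ht, abs_div, abs_of_pos hnP]
    exact div_le_div₀ hB0 (hB a) hnp0 (hnp a)
  have ht2 : |t| ≤ 1 / 2 := htB.trans (by rw [div_le_div_iff₀ hnp0 two_pos]; linarith)
  have h1 : |Real.log (Stirling.stirlingSeq (N a)) - Real.log √Real.pi| ≤ 1 / (n * p) := by
    rw [abs_of_nonneg (sub_nonneg.2 (log_sqrt_pi_le_log_stirlingSeq (hpos a)))]
    have h2 : 1 / (2 * (N a : ℝ)) ≤ 1 / (n * p) :=
      one_div_le_one_div_of_le hnp0 (by linarith [hNbig a])
    linarith [log_stirlingSeq_le (hpos a)]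
  have h2 : |1 / 2 * Real.log (N a / (n * P a))| ≤ B / (n * p) := by
    rw [ht1, abs_mul, abs_of_pos (by norm_num : (0 : ℝ) < 1 / 2)]
    linarith [abs_log_one_add_le ht2]
  have h3 : |(N a * Real.log (N a / (n * P a)) - (N a - n * P a)) -
      1 / 2 * ((N a - n * P a) ^ 2 / (n * P a))| ≤ 4 * B ^ 3 / (n * p) ^ 2 := by
    have e1 : (N a * Real.log (N a / (n * P a)) - (N a - n * P a)) -
        1 / 2 * ((N a - n * P a) ^ 2 / (n * P a)) =
        n * P a * ((1 + t) * Real.log (1 + t) - t - t ^ 2 / 2) := by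
      rw [ht1, hNt, hNt']
      field_simp
    rw [e1, abs_mul, abs_of_pos hnP]
    calc _ ≤ n * P a * (4 * |t| ^ 3) := by gcongr; exact abs_one_add_mul_log_sub_le ht2
      _ = 4 * |(N a : ℝ) - n * P a| ^ 3 / (n * P a) ^ 2 := by
          rw [hNt, abs_mul, abs_of_pos hnP]; field_simp
      _ ≤ _ := by
          gcongr
          · exact hB a
          · exact hpP a
  have e2 : ∀ x y z w : ℝ, x + y + z - w = x + (y + (z - w)) := fun x y z w => by ring
  rw [e2]
  refine (abs_add_le _ _).trans ?_
  have := abs_add_le (1 / 2 * Real.log (N a / (n * P a)))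
    ((N a * Real.log (N a / (n * P a)) - (N a - n * P a)) -
      1 / 2 * ((N a - n * P a) ^ 2 / (n * P a)))
  linarith

/-! ### The metric projection and the chart -/

theorem nearestPoint_spec {k : ℕ} {S : Set (Vec k)} (hS : IsClosed S) (hne : S.Nonempty)
    (y : Vec k) : nearestPoint S y ∈ S ∧ ∀ q ∈ S, ‖y - nearestPoint S y‖ ≤ ‖y - q‖ := by
  apply Classical.epsilon_spec (p := fun p => p ∈ S ∧ ∀ q ∈ S, ‖y - p‖ ≤ ‖y - q‖)
  obtain ⟨p, hp, h⟩ := hS.exists_infDist_eq_dist hne y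
  refine ⟨p, hp, fun q hq => ?_⟩
  rw [← dist_eq_norm, ← dist_eq_norm, ← h]
  exact Metric.infDist_le_dist_of_mem hq

theorem nearestPoint_eq_self {k : ℕ} {S : Set (Vec k)} (hS : IsClosed S) {y : Vec k}
    (hy : y ∈ S) : nearestPoint S y = y := by
  have := (nearestPoint_spec hS ⟨y, hy⟩ y).2 y hy
  rw [sub_self, norm_zero, norm_le_zero_iff, sub_eq_zero] at this
  exact this.symm

theorem inner_sub_nearestPoint_nonpos {k : ℕ} {S : Set (Vec k)} (hS : IsClosed S)
    (hc : Convex ℝ S) (y : Vec k) {q : Vec k} (hq : q ∈ S) :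
    inner ℝ (y - nearestPoint S y) (q - nearestPoint S y) ≤ 0 := by
  obtain ⟨h1, h2⟩ := nearestPoint_spec hS ⟨q, hq⟩ y
  refine (norm_eq_iInf_iff_real_inner_le_zero hc h1).1 ?_ q hq
  have : Nonempty S := ⟨⟨q, hq⟩⟩
  refine le_antisymm (le_ciInf fun w => h2 w w.2) ?_
  exact ciInf_le (f := fun w : S => ‖y - w‖) ⟨0, by rintro _ ⟨w, rfl⟩; exact norm_nonneg _⟩ ⟨_, h1⟩

/-- Adding the two obtuse-angle inequalities gives `‖p - p'‖² ≤ ⟨y - y', p - p'⟩`. The result serves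
to make the integrand continuous, hence measurable. -/
theorem norm_nearestPoint_sub_le {k : ℕ} {S : Set (Vec k)} (hS : IsClosed S)
    (hc : Convex ℝ S) (hne : S.Nonempty) (y y' : Vec k) :
    ‖nearestPoint S y - nearestPoint S y'‖ ≤ ‖y - y'‖ := by
  have h1 := inner_sub_nearestPoint_nonpos hS hc y (nearestPoint_spec hS hne y').1
  have h2 := inner_sub_nearestPoint_nonpos hS hc y' (nearestPoint_spec hS hne y).1
  set p := nearestPoint S y
  set p' := nearestPoint S y'
  have h3 : inner ℝ (p - p') (p - p') ≤ inner ℝ (y - y') (p - p') := by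
    have e : inner ℝ (y - y') (p - p') - inner ℝ (p - p') (p - p') =
        -(inner ℝ (y - p) (p' - p) + inner ℝ (y' - p') (p - p')) := by
      simp only [inner_sub_left, inner_sub_right]
      ring
    linarith
  have h4 := h3.trans (real_inner_le_norm _ _)
  rw [real_inner_self_eq_norm_sq, sq] at h4
  rcases (norm_nonneg (p - p')).eq_or_lt with h0 | h0
  · rw [← h0]; exact norm_nonneg _
  · exact le_of_mul_le_mul_right h4 h0

theorem continuous_nearestPoint {k : ℕ} {S : Set (Vec k)} (hS : IsClosed S)
    (hc : Convex ℝ S) (hne : S.Nonempty) : Continuous (nearestPoint S) := by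
  refine (LipschitzWith.of_dist_le_mul (K := 1) fun y y' => ?_).continuous
  rw [dist_eq_norm, dist_eq_norm, NNReal.coe_one, one_mul]
  exact norm_nearestPoint_sub_le hS hc hne y y'

theorem continuous_moment {k d : ℕ} (h : Fin k → Fin d → ℝ) : Continuous (moment h) := by
  unfold moment
  fun_prop

theorem isClosed_closedFeasible {k d : ℕ} (h : Fin k → Fin d → ℝ) (α : Fin d → ℝ) :
    IsClosed (closedFeasible h α) := by
  have e : closedFeasible h α = (⋂ x, {P : Vec k | 0 ≤ P x}) ∩
      ({P : Vec k | ∑ x, P x = 1} ∩ {P | moment h P = α}) := by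
    ext P
    simp [closedFeasible]
  rw [e]
  refine IsClosed.inter (isClosed_iInter fun x => isClosed_le continuous_const (by fun_prop)) ?_
  exact IsClosed.inter (isClosed_eq (by fun_prop) continuous_const)
    (isClosed_eq (continuous_moment h) continuous_const)

theorem convex_closedFeasible {k d : ℕ} (h : Fin k → Fin d → ℝ) (α : Fin d → ℝ) :
    Convex ℝ (closedFeasible h α) := by
  rintro P ⟨hP1, hP2, hP3⟩ R ⟨hR1, hR2, hR3⟩ s t hs ht hst
  refine ⟨fun x => ?_, ?_, ?_⟩
  · simp only [PiLp.add_apply, PiLp.smul_apply, smul_eq_mul]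
    have := hP1 x
    have := hR1 x
    positivity
  · simp [sum_add_distrib, ← mul_sum, hP2, hR2, hst]
  · have : moment h (s • P + t • R) = s • moment h P + t • moment h R := by
      simp [moment, add_smul, sum_add_distrib, mul_smul, smul_sum]
    rw [this, hP3, hR3, ← add_smul, hst, one_smul]

theorem feasible_subset_closedFeasible {k d : ℕ} (h : Fin k → Fin d → ℝ) (α : Fin d → ℝ) :
    feasible h α ⊆ closedFeasible h α :=
  fun _ hP => ⟨fun x => (hP.1.1 x).le, hP.1.2, hP.2⟩

theorem localChart_mem {k d : ℕ} {h : Fin k → Fin d → ℝ} {α : Fin d → ℝ} {P : Vec k}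
    (hP : P ∈ feasible h α) (n : ℕ) (v : tangentSpace h) :
    localChart h α P n v ∈ closedFeasible h α :=
  (nearestPoint_spec (isClosed_closedFeasible h α) ⟨P, feasible_subset_closedFeasible h α hP⟩ _).1

theorem localChart_eq {k d : ℕ} {h : Fin k → Fin d → ℝ} {α : Fin d → ℝ} {P : Vec k}
    (hP : P ∈ feasible h α) (n : ℕ) (v : tangentSpace h)
    (hv : ∀ a, 0 < (P + (Real.sqrt n)⁻¹ • (v : Vec k)) a) :
    localChart h α P n v = P + (Real.sqrt n)⁻¹ • (v : Vec k) := by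
  refine nearestPoint_eq_self (isClosed_closedFeasible h α) (feasible_subset_closedFeasible h α ?_)
  refine (mem_feasible_iff hP).2 ⟨hv, ?_⟩
  rw [add_sub_cancel_left]
  exact Submodule.smul_mem _ _ v.2

theorem continuous_iidProb_localChart {k d : ℕ} {h : Fin k → Fin d → ℝ} {α : Fin d → ℝ}
    {P : Vec k} (hP : P ∈ feasible h α) (n m : ℕ) (A : Set (Fin m → Fin k)) :
    Continuous fun v : tangentSpace h => iidProb (localChart h α P n v) m A := by
  classical
  have h1 : Continuous fun v : tangentSpace h => localChart h α P n v :=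
    (continuous_nearestPoint (isClosed_closedFeasible h α) (convex_closedFeasible h α)
      ⟨P, feasible_subset_closedFeasible h α hP⟩).comp (by fun_prop)
  simp only [iidProb, Set.indicator_apply]
  refine continuous_finsetSum _ fun x _ => ?_
  split_ifs
  · fun_prop
  · exact continuous_const

/-! ### Gaussian integrals on a subspace -/

/-- The unnormalized Gaussian density with precision matrix `diag(1/P)`. -/
def gaussianKernel {k : ℕ} (P v : Vec k) : ℝ :=
  Real.exp (-(1 / 2) * ∑ a, v a ^ 2 / P a)

theorem continuous_gaussianKernel {k : ℕ} (P : Vec k) : Continuous (gaussianKernel P) := by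
  unfold gaussianKernel
  fun_prop

theorem gaussianKernel_pos {k : ℕ} (P v : Vec k) : 0 < gaussianKernel P v := Real.exp_pos _

theorem inner_tangentHessian {k d : ℕ} (h : Fin k → Fin d → ℝ) (P : Vec k)
    (v w : tangentSpace h) :
    inner ℝ v (tangentHessian h P w) = ∑ a, v.1 a * w.1 a / P a := by
  have e1 : ((tangentHessian h P w : tangentSpace h) : Vec k) =
      (tangentSpace h).starProjection (ambientHessian P ((tangentSpace h).starProjection w)) := rfl
  rw [Submodule.coe_inner, e1, Submodule.starProjection_eq_self_iff.2 w.2,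
    ← Submodule.inner_starProjection_left_eq_right, Submodule.starProjection_eq_self_iff.2 v.2]
  simp only [ambientHessian, PiLp.inner_apply, Matrix.toLpLin_apply, Matrix.mulVec_diagonal]
  refine sum_congr rfl fun a _ => ?_
  simp
  ring

/-- The Gaussian integral over a subspace, with the determinant of the restricted precision. -/
theorem exists_sq_eq_det_and_integral_gaussianKernel {k : ℕ} {P : Vec k} (hP : ∀ a, 0 < P a)
    (T : Submodule ℝ (Vec k)) (H : T →ₗ[ℝ] T)
    (hH : ∀ v w : T, inner ℝ v (H w) = ∑ a, v.1 a * w.1 a / P a) :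
    ∃ δ : ℝ, 0 < δ ∧ δ ^ 2 = LinearMap.det H ∧
      ∫ v : T, gaussianKernel P v = δ⁻¹ * (2 * Real.pi) ^ ((Module.finrank ℝ T : ℝ) / 2) := by
  -- `v ↦ v/√P` turns the quadratic form of `H` into the Euclidean one. Its image is carried back to
  -- `T` by an isometry, so that the composite `M` has a determinant.
  let B : T →ₗ[ℝ] Vec k :=
    { toFun := fun v => WithLp.toLp 2 fun a => v.1 a / √(P a)
      map_add' := fun v w => by ext a; simp [add_div]
      map_smul' := fun c v => by ext a; simp [mul_div_assoc] }
  have hB : ∀ v w, inner ℝ (B v) (B w) = ∑ a, v.1 a * w.1 a / P a := by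
    intro v w
    simp only [B, PiLp.inner_apply, LinearMap.coe_mk, AddHom.coe_mk]
    refine sum_congr rfl fun a _ => ?_
    simp only [RCLike.inner_apply, conj_trivial]
    rw [div_mul_div_comm, Real.mul_self_sqrt (hP a).le, mul_comm]
  have hinj : Function.Injective B := by
    intro v w hvw
    ext a
    have := congrArg (fun z : Vec k => z a) hvw
    have hs := (Real.sqrt_pos.2 (hP a)).ne'
    simpa [B, div_left_inj' hs] using this
  have hfr : Module.finrank ℝ (LinearMap.range B) = Module.finrank ℝ T :=
    LinearMap.finrank_range_of_inj hinj
  let U : LinearMap.range B ≃ₗᵢ[ℝ] T :=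
    (stdOrthonormalBasis ℝ (LinearMap.range B)).equiv (stdOrthonormalBasis ℝ T) (finCongr hfr)
  let M : T →ₗ[ℝ] T := U.toLinearEquiv.toLinearMap ∘ₗ B.rangeRestrict
  have hM : ∀ v w, inner ℝ (M v) (M w) = ∑ a, v.1 a * w.1 a / P a := by
    intro v w
    rw [← hB]
    exact U.inner_map_map _ _
  have hMinj : Function.Injective M := by
    intro v w hvw
    apply hinj
    have : B.rangeRestrict v = B.rangeRestrict w := U.injective hvw
    exact congrArg Subtype.val this
  have hdet : LinearMap.det M ≠ 0 := by
    have hb : Function.Bijective M := ⟨hMinj, LinearMap.injective_iff_surjective.1 hMinj⟩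
    exact (LinearEquiv.isUnit_det' (LinearEquiv.ofBijective M hb)).ne_zero
  -- Hence `det H = (det M)²`, and the substitution `v ↦ M v` yields a standard Gaussian integral.
  have hHM : H = LinearMap.adjoint M ∘ₗ M := by
    ext1 w
    refine ext_inner_left ℝ fun v => ?_
    rw [hH, LinearMap.comp_apply, LinearMap.adjoint_inner_right, hM]
  refine ⟨|LinearMap.det M|, abs_pos.2 hdet, ?_, ?_⟩
  · have hadj : LinearMap.det (LinearMap.adjoint M) = LinearMap.det M := by
      have b := stdOrthonormalBasis ℝ T
      rw [← LinearMap.det_toMatrix b.toBasis, LinearMap.toMatrix_adjoint, Matrix.det_conjTranspose,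
        LinearMap.det_toMatrix, star_trivial]
    rw [hHM, LinearMap.det_comp, hadj, sq_abs, sq]
  · have h1 : ∀ v : T, gaussianKernel P v = Real.exp (-(1 / 2) * ‖M v‖ ^ 2) := by
      intro v
      rw [← real_inner_self_eq_norm_sq, hM, gaussianKernel]
      simp only [sq]
    have hMc : Continuous M := LinearMap.continuous_of_finiteDimensional M
    simp only [h1]
    rw [← integral_map (f := fun v : T => Real.exp (-(1 / 2) * ‖v‖ ^ 2)) hMc.aemeasurable
      (Continuous.aestronglyMeasurable (by fun_prop)),
      Measure.map_linearMap_addHaar_eq_smul_addHaar _ hdet, integral_smul_measure,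
      GaussianFourier.integral_rexp_neg_mul_sq_norm (by norm_num), abs_inv,
      ENNReal.toReal_ofReal (by positivity), smul_eq_mul]
    congr 2
    ring

theorem tangentLebesgue_eq_volume {k d : ℕ} (h : Fin k → Fin d → ℝ) :
    tangentLebesgue h = volume :=
  (stdOrthonormalBasis ℝ (tangentSpace h)).addHaar_eq_volume

/-- The determinant and the powers of `2π` are exactly the normalization, so from here on only the
kernel and its integral are needed. -/
theorem gaussianDensity_eq {k d : ℕ} (h : Fin k → Fin d → ℝ) {P : Vec k} (hP : ∀ a, 0 < P a)
    (v : tangentSpace h) : gaussianDensity h P v =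
      (∫ w : tangentSpace h, gaussianKernel P w)⁻¹ * gaussianKernel P v := by
  obtain ⟨δ, hδ, hdet, hI⟩ := exists_sq_eq_det_and_integral_gaussianKernel hP (tangentSpace h)
    (tangentHessian h P) (inner_tangentHessian h P)
  rw [hI, gaussianDensity, ← hdet, Real.sqrt_sq hδ.le, inner_tangentHessian, mul_inv, inv_inv,
    neg_div, Real.rpow_neg (by positivity), gaussianKernel]
  simp only [sq]

theorem integrable_exp_neg_mul_sq_norm {k : ℕ} (T : Submodule ℝ (Vec k)) {c : ℝ} (hc : 0 < c) :
    Integrable fun v : T => Real.exp (-c * ‖v‖ ^ 2) := by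
  refine .of_integral_ne_zero ?_
  rw [GaussianFourier.integral_rexp_neg_mul_sq_norm hc]
  positivity

theorem gaussianKernel_le {k : ℕ} {P : Vec k} (hP : ∀ a, 0 < P a) (hP1 : ∀ a, P a ≤ 1)
    (v : Vec k) : gaussianKernel P v ≤ Real.exp (-(1 / 2) * ‖v‖ ^ 2) := by
  rw [gaussianKernel, EuclideanSpace.real_norm_sq_eq]
  gcongr Real.exp ?_
  have : ∑ a, v a ^ 2 ≤ ∑ a, v a ^ 2 / P a :=
    sum_le_sum fun a _ => le_div_self (sq_nonneg _) (hP a) (hP1 a)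
  linarith

/-- The lower bound depends on `P` through `p` alone; it bounds the normalizing integral from below
uniformly in `P`. -/
theorem le_gaussianKernel {k : ℕ} {P : Vec k} {p : ℝ} (hp : 0 < p) (hP : ∀ a, p ≤ P a)
    (v : Vec k) : Real.exp (-(1 / (2 * p)) * ‖v‖ ^ 2) ≤ gaussianKernel P v := by
  rw [gaussianKernel, EuclideanSpace.real_norm_sq_eq]
  gcongr Real.exp ?_
  have : ∑ a, v a ^ 2 / P a ≤ ∑ a, v a ^ 2 / p := by
    gcongr with a
    exact hP a
  rw [← sum_div] at this
  have e : -(1 / (2 * p)) * ∑ a, v a ^ 2 = -(1 / 2) * ((∑ a, v a ^ 2) / p) := by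
    field_simp
  rw [e]
  linarith

theorem integrable_gaussianKernel {k : ℕ} {P : Vec k} (hP : ∀ a, 0 < P a) (hP1 : ∀ a, P a ≤ 1)
    (T : Submodule ℝ (Vec k)) : Integrable fun v : T => gaussianKernel P v := by
  refine (integrable_exp_neg_mul_sq_norm T (c := 1 / 2) (by norm_num)).mono'
    ((continuous_gaussianKernel P).comp continuous_subtype_val).aestronglyMeasurable
    (Filter.Eventually.of_forall fun v => ?_)
  rw [Real.norm_of_nonneg (gaussianKernel_pos P v).le]
  exact gaussianKernel_le hP hP1 v

/-! ### Lattices and Riemann sums -/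

/-- If the integer vectors of a subspace span it, then they are the integer combinations of a
basis. -/
theorem exists_basis_integer_span {k : ℕ} (T : Submodule ℝ (Vec k))
    (hT : Submodule.span ℝ {v : Vec k | v ∈ T ∧ ∀ x, ∃ z : ℤ, v x = z} = T) :
    ∃ (ι : Type) (_ : Fintype ι) (b : Module.Basis ι ℝ T), ∀ v : T,
      v ∈ Submodule.span ℤ (Set.range b) ↔ ∀ x, ∃ z : ℤ, (v : Vec k) x = z := by
  let e := (EuclideanSpace.basisFun (Fin k) ℝ).toBasis
  let L₀ : Submodule ℤ (Vec k) := Submodule.span ℤ (Set.range e)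
  let L : Submodule ℤ T := ZLattice.comap ℝ L₀ T.subtype
  have hmem : ∀ v : T, v ∈ L ↔ ∀ x, ∃ z : ℤ, (v : Vec k) x = z := by
    intro v
    change (v : Vec k) ∈ Submodule.span ℤ (Set.range e) ↔ _
    rw [Module.Basis.mem_span_iff_repr_mem]
    refine forall_congr' fun x => ?_
    simp [e, eq_comm]
  have hdisc : DiscreteTopology L :=
    ZLattice.comap_discreteTopology ℝ L₀ (e := T.subtype) continuous_subtype_val
      T.injective_subtype
  -- Full rank of the trace of `ℤ^k` on `T` is the spanning hypothesis; without it the trace would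
  -- be discrete but too thin.
  have hspan : IsZLattice ℝ L := by
    refine ⟨Submodule.map_injective_of_injective T.injective_subtype ?_⟩
    rw [Submodule.map_span, Submodule.map_subtype_top]
    convert hT using 2
    ext v
    constructor
    · rintro ⟨w, hw, rfl⟩
      exact ⟨w.2, (hmem w).1 hw⟩
    · rintro ⟨h1, h2⟩
      exact ⟨⟨v, h1⟩, (hmem _).2 h2, rfl⟩
  have hfree : Module.Free ℤ L := ZLattice.module_free ℝ L
  have hfin : Module.Finite ℤ L := ZLattice.module_finite ℝ L
  let b := Module.Free.chooseBasis ℤ L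
  refine ⟨_, inferInstance, b.ofZLatticeBasis ℝ L, fun v => ?_⟩
  rw [b.ofZLatticeBasis_span ℝ L, hmem]

/-- Here `t` is the set of central points, `D i` their cells of common volume `V`, and `c * G` the
limiting weight. Relative to `c ∫ G`, the cells contribute `2ε`, one `ε` for the weights and one for
the values; the points outside `t` and the uncovered part of the space contribute `ε` each. -/
theorem abs_mul_sum_sub_integral_le {E ι : Type*} [DecidableEq ι] [MeasurableSpace E] {μ : Measure E}
    {s t : Finset ι} (hts : t ⊆ s) {w γ : ι → ℝ} {D : ι → Set E} {G π : E → ℝ} {c ε V : ℝ}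
    (hw : ∀ i ∈ s, 0 ≤ w i) (hγ0 : ∀ i, 0 ≤ γ i) (hγ1 : ∀ i, γ i ≤ 1)
    (hD : ∀ i ∈ t, MeasurableSet (D i)) (hdisj : (t : Set ι).PairwiseDisjoint D)
    (hV : 0 < V) (hDV : ∀ i ∈ t, μ.real (D i) = V) (hG : Integrable G μ) (hG0 : ∀ v, 0 ≤ G v)
    (hπ : AEStronglyMeasurable π μ) (hπ0 : ∀ v, 0 ≤ π v) (hπ1 : ∀ v, π v ≤ 1) (hc : 0 < c)
    (hε : 0 ≤ ε)
    (h1 : ∀ i ∈ t, ∀ v ∈ D i, |w i - c * G v| ≤ ε * (c * G v))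
    (h2 : ∀ i ∈ t, ∀ v ∈ D i, |γ i - π v| ≤ ε)
    (h3 : V * ∑ i ∈ s \ t, w i ≤ ε * (c * ∫ v, G v ∂μ))
    (h4 : ∫ v in (⋃ i ∈ t, D i)ᶜ, G v ∂μ ≤ ε * ∫ v, G v ∂μ) :
    |V * ∑ i ∈ s, w i * γ i - c * ∫ v, π v * G v ∂μ| ≤ 4 * ε * (c * ∫ v, G v ∂μ) := by
  have hπG : Integrable (fun v => π v * G v) μ := by
    refine hG.mono' (hπ.mul hG.aestronglyMeasurable) (Filter.Eventually.of_forall fun v => ?_)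
    rw [Real.norm_of_nonneg (mul_nonneg (hπ0 v) (hG0 v))]
    exact mul_le_of_le_one_left (hG0 v) (hπ1 v)
  set U := ⋃ i ∈ t, D i with hU
  have hUm : MeasurableSet U := t.measurableSet_biUnion hD
  have hsplit : ∀ f : E → ℝ, Integrable f μ →
      ∫ v, f v ∂μ = ∑ i ∈ t, ∫ v in D i, f v ∂μ + ∫ v in Uᶜ, f v ∂μ := by
    intro f hf
    rw [← integral_biUnion_finset t hD hdisj fun i _ => hf.integrableOn,
      integral_add_compl hUm hf]
  have hsum : ∑ i ∈ s, w i * γ i = ∑ i ∈ t, w i * γ i + ∑ i ∈ s \ t, w i * γ i := by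
    rw [add_comm, sum_sdiff hts]
  set I := ∫ v, G v ∂μ with hI
  have hcell : ∀ i ∈ t, |V * (w i * γ i) - c * ∫ v in D i, π v * G v ∂μ| ≤
      2 * ε * (c * ∫ v in D i, G v ∂μ) := by
    intro i hi
    have hfin : μ (D i) ≠ ⊤ := by
      intro h
      have := hDV i hi
      rw [measureReal_def, h] at this
      simp at this
      linarith
    have e1 : V * (w i * γ i) - c * ∫ v in D i, π v * G v ∂μ =
        ∫ v in D i, (w i * γ i - c * (π v * G v)) ∂μ := by
      rw [integral_sub (integrableOn_const (C := w i * γ i) hfin) (hπG.integrableOn.const_mul c),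
        setIntegral_const, integral_const_mul, hDV i hi, smul_eq_mul]
    have e2 : 2 * ε * (c * ∫ v in D i, G v ∂μ) = ∫ v in D i, 2 * ε * (c * G v) ∂μ := by
      rw [integral_const_mul, integral_const_mul]
    rw [e1, e2, ← Real.norm_eq_abs]
    refine norm_integral_le_of_norm_le ((hG.integrableOn.const_mul c).const_mul _) ?_
    refine (ae_restrict_iff' (hD i hi)).2 (Filter.Eventually.of_forall fun v hv => ?_)
    have e3 : w i * γ i - c * (π v * G v) =
        (w i - c * G v) * γ i + (c * G v) * (γ i - π v) := by ring
    rw [Real.norm_eq_abs, e3]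
    refine (abs_add_le _ _).trans ?_
    have hcG : 0 ≤ c * G v := mul_nonneg hc.le (hG0 v)
    rw [abs_mul, abs_mul, abs_of_nonneg hcG, abs_of_nonneg (hγ0 i)]
    have a1 : |w i - c * G v| * γ i ≤ ε * (c * G v) :=
      (mul_le_of_le_one_right (abs_nonneg _) (hγ1 i)).trans (h1 i hi v hv)
    have a2 : c * G v * |γ i - π v| ≤ c * G v * ε := by gcongr; exact h2 i hi v hv
    linarith
  have hcells : |∑ i ∈ t, (V * (w i * γ i) - c * ∫ v in D i, π v * G v ∂μ)| ≤
      2 * ε * (c * I) := by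
    refine (abs_sum_le_sum_abs _ _).trans ((sum_le_sum hcell).trans ?_)
    rw [← mul_sum, ← mul_sum]
    gcongr
    rw [hI, hsplit G hG]
    exact le_add_of_nonneg_right (integral_nonneg hG0)
  have hbad0 : 0 ≤ V * ∑ i ∈ s \ t, w i * γ i :=
    mul_nonneg hV.le (sum_nonneg fun i hi => mul_nonneg (hw i (mem_sdiff.1 hi).1) (hγ0 i))
  have hbad1 : V * ∑ i ∈ s \ t, w i * γ i ≤ ε * (c * I) := by
    refine le_trans ?_ h3
    gcongr with i hi
    exact mul_le_of_le_one_right (hw i (mem_sdiff.1 hi).1) (hγ1 i)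
  have hout0 : 0 ≤ c * ∫ v in Uᶜ, π v * G v ∂μ :=
    mul_nonneg hc.le (integral_nonneg fun v => mul_nonneg (hπ0 v) (hG0 v))
  have hout1 : c * ∫ v in Uᶜ, π v * G v ∂μ ≤ ε * (c * I) := by
    rw [mul_left_comm]
    gcongr
    refine le_trans ?_ h4
    exact integral_mono hπG.integrableOn hG.integrableOn
      fun v => mul_le_of_le_one_left (hG0 v) (hπ1 v)
  have e : V * ∑ i ∈ s, w i * γ i - c * ∫ v, π v * G v ∂μ =
      ∑ i ∈ t, (V * (w i * γ i) - c * ∫ v in D i, π v * G v ∂μ) +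
      V * ∑ i ∈ s \ t, w i * γ i - c * ∫ v in Uᶜ, π v * G v ∂μ := by
    rw [hsum, hsplit _ hπG, sum_sub_distrib, ← mul_sum, ← mul_sum]
    ring
  rw [e, abs_le]
  rw [abs_le] at hcells
  constructor <;> linarith [hcells.1, hcells.2]

/-- Comparison of a weighted average over the points of a lattice with an average over the
space that is tiled by its cells. -/
theorem abs_average_sub_average_le {E ι : Type*} [DecidableEq ι] [MeasurableSpace E] {μ : Measure E}
    {s t : Finset ι} (hts : t ⊆ s) {w γ : ι → ℝ} {D : ι → Set E} {G π : E → ℝ} {c ε V : ℝ}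
    (hw : ∀ i ∈ s, 0 < w i) (hs : s.Nonempty) (hγ0 : ∀ i, 0 ≤ γ i) (hγ1 : ∀ i, γ i ≤ 1)
    (hD : ∀ i ∈ t, MeasurableSet (D i)) (hdisj : (t : Set ι).PairwiseDisjoint D)
    (hV : 0 < V) (hDV : ∀ i ∈ t, μ.real (D i) = V) (hG : Integrable G μ) (hG0 : ∀ v, 0 ≤ G v)
    (hI : 0 < ∫ v, G v ∂μ)
    (hπ : AEStronglyMeasurable π μ) (hπ0 : ∀ v, 0 ≤ π v) (hπ1 : ∀ v, π v ≤ 1) (hc : 0 < c)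
    (hε : 0 ≤ ε)
    (h1 : ∀ i ∈ t, ∀ v ∈ D i, |w i - c * G v| ≤ ε * (c * G v))
    (h2 : ∀ i ∈ t, ∀ v ∈ D i, |γ i - π v| ≤ ε)
    (h3 : V * ∑ i ∈ s \ t, w i ≤ ε * (c * ∫ v, G v ∂μ))
    (h4 : ∫ v in (⋃ i ∈ t, D i)ᶜ, G v ∂μ ≤ ε * ∫ v, G v ∂μ) :
    |(∑ i ∈ s, w i * γ i) / ∑ i ∈ s, w i - (∫ v, G v ∂μ)⁻¹ * ∫ v, π v * G v ∂μ| ≤ 8 * ε := by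
  have hW := abs_mul_sum_sub_integral_le hts (fun i hi => (hw i hi).le) hγ0 hγ1 hD hdisj hV hDV hG
    hG0 hπ hπ0 hπ1 hc hε h1 h2 h3 h4
  -- Constant values `1` give the same comparison for the denominators.
  have hZ := abs_mul_sum_sub_integral_le (γ := fun _ => 1) (π := fun _ => 1) hts
    (fun i hi => (hw i hi).le) (fun _ => zero_le_one) (fun _ => le_rfl) hD hdisj hV hDV hG
    hG0 aestronglyMeasurable_const (fun _ => zero_le_one) (fun _ => le_rfl) hc hε h1
    (fun i _ v _ => by simpa using hε) h3 h4
  simp only [mul_one, one_mul] at hZ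
  have hW0 : 0 ≤ ∑ i ∈ s, w i * γ i := sum_nonneg fun i hi => mul_nonneg (hw i hi).le (hγ0 i)
  have hWZ : ∑ i ∈ s, w i * γ i ≤ ∑ i ∈ s, w i :=
    sum_le_sum fun i hi => mul_le_of_le_one_right (hw i hi).le (hγ1 i)
  have hZ0 : 0 < ∑ i ∈ s, w i := sum_pos hw hs
  set W := ∑ i ∈ s, w i * γ i
  set Z := ∑ i ∈ s, w i
  set I := ∫ v, G v ∂μ
  set J := ∫ v, π v * G v ∂μ
  have hcI : 0 < c * I := mul_pos hc hI
  -- In this form `Z` occurs only in `W / Z ≤ 1`, so no quantitative lower bound on `Z` is needed;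
  -- each bracket is at most `4ε (c I)`.
  have e : W / Z - I⁻¹ * J = (W / Z * -(V * Z - c * I) + (V * W - c * J)) / (c * I) := by
    field_simp
    ring
  rw [e, abs_div, abs_of_pos hcI, div_le_iff₀ hcI]
  refine (abs_add_le _ _).trans ?_
  have hq0 : 0 ≤ W / Z := div_nonneg hW0 hZ0.le
  have hq1 : W / Z ≤ 1 := (div_le_one hZ0).2 hWZ
  rw [abs_mul, abs_neg, abs_of_nonneg hq0]
  have := mul_le_mul hq1 hZ (abs_nonneg _) zero_le_one
  linarith

/-! ### Estimates on a single cell -/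

/-- The local limit theorem for the weight of a type, compared with the Gaussian kernel at a
nearby point. -/
theorem abs_typeWeight_sub_le {k n : ℕ} (hn : 0 < n) {P : Vec k} {p : ℝ} (hp : 0 < p)
    (hpP : ∀ a, p ≤ P a) (hP1 : ∑ a, P a = 1) {N : Fin k → ℕ} (hN : ∑ a, N a = n)
    {v : Vec k} {R ρ : ℝ} (hR : 1 ≤ R)
    (hu : ‖WithLp.toLp 2 (fun a => (N a : ℝ)) - (n : ℝ) • P‖ ≤ √n * R)
    (hv : ‖√n • v - (WithLp.toLp 2 (fun a => (N a : ℝ)) - (n : ℝ) • P)‖ ≤ ρ)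
    (hρ : ρ ≤ √n) (hRn : 2 * (√n * R) ≤ p * n)
    (hsmall : k * (2 / p + 4 / p ^ 2 + 2 * ρ / p) * (R ^ 3 / √n) ≤ 1) :
    |typeWeight P n N - Real.exp (logNorm P n) * gaussianKernel P v| ≤
      2 * (k * (2 / p + 4 / p ^ 2 + 2 * ρ / p) * (R ^ 3 / √n)) *
        (Real.exp (logNorm P n) * gaussianKernel P v) := by
  have hn' : (0 : ℝ) < n := by exact_mod_cast hn
  have hP : ∀ a, 0 < P a := fun a => hp.trans_le (hpP a)
  set s := √(n : ℝ) with hs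
  have hs0 : 0 < s := Real.sqrt_pos.2 hn'
  have hs1 : 1 ≤ s := by
    rw [hs, Real.one_le_sqrt]
    exact_mod_cast hn
  have hns : (n : ℝ) = s ^ 2 := (Real.sq_sqrt hn'.le).symm
  set u : Vec k := WithLp.toLp 2 (fun a => (N a : ℝ)) - (n : ℝ) • P with hudef
  have hua : ∀ a, u a = N a - n * P a := fun a => by simp [hudef]
  have hρ0 : 0 ≤ ρ := (norm_nonneg _).trans hv
  have hR3 : R ≤ R ^ 3 := le_self_pow₀ hR (by norm_num)
  have hR31 : 1 ≤ R ^ 3 := one_le_pow₀ hR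
  have h1 := abs_log_typeWeight_sub_le hn hp hpP hP1 hN (B := s * R)
    (fun a => by rw [← hua, ← Real.norm_eq_abs]; exact (PiLp.norm_apply_le u a).trans hu) hRn
  have h1' : k * (1 / (n * p) + s * R / (n * p) + 4 * (s * R) ^ 3 / (n * p) ^ 2) ≤
      k * (2 / p + 4 / p ^ 2) * (R ^ 3 / s) := by
    rw [mul_assoc]
    gcongr
    have a1 : 1 / (n * p) ≤ R ^ 3 / s / p := by
      rw [hns, div_div]
      gcongr
      nlinarith
    have a2 : s * R / (n * p) ≤ R ^ 3 / s / p := by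
      have : s * R / (n * p) = R / s / p := by rw [hns]; field_simp
      rw [this]
      gcongr
    have a3 : 4 * (s * R) ^ 3 / (n * p) ^ 2 = 4 / p ^ 2 * (R ^ 3 / s) := by
      rw [hns]; field_simp
    have a4 : (2 / p + 4 / p ^ 2) * (R ^ 3 / s) =
        R ^ 3 / s / p + R ^ 3 / s / p + 4 / p ^ 2 * (R ^ 3 / s) := by ring
    linarith
  set y : Vec k := s⁻¹ • u with hy
  have hyR : ‖y‖ ≤ R := by
    rw [hy, norm_smul, norm_inv, Real.norm_of_nonneg hs0.le, inv_mul_le_iff₀ hs0]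
    exact hu
  have hyv : ‖v - y‖ ≤ ρ / s := by
    have e : v - y = s⁻¹ • (s • v - u) := by
      rw [smul_sub, smul_smul, inv_mul_cancel₀ hs0.ne', one_smul]
    rw [e, norm_smul, norm_inv, Real.norm_of_nonneg hs0.le, inv_mul_le_iff₀ hs0,
      mul_div_cancel₀ _ hs0.ne']
    exact hv
  have hyv' : ‖v + y‖ ≤ 3 * R := by
    have e : v + y = (v - y) + (2 : ℝ) • y := by module
    have h2 : ρ / s ≤ R := ((div_le_one hs0).2 hρ).trans hR
    rw [e]
    refine (norm_add_le _ _).trans ?_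
    rw [norm_smul, Real.norm_two]
    linarith
  -- The two quadratic forms differ by products `(v - y)_a (v + y)_a`, where the first factor is at
  -- most the cell size `ρ/√n` and the second at most `3R`.
  have h2 : |1 / 2 * ∑ a, v a ^ 2 / P a - 1 / 2 * ∑ a, (N a - n * P a) ^ 2 / (n * P a)| ≤
      k * (2 * ρ / p) * (R ^ 3 / s) := by
    rw [mul_sum, mul_sum, ← sum_sub_distrib]
    refine (abs_sum_le_sum_abs _ _).trans ?_
    have : k * (2 * ρ / p) * (R ^ 3 / s) = ∑ _a : Fin k, (2 * ρ / p) * (R ^ 3 / s) := by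
      rw [sum_const, card_univ, Fintype.card_fin, nsmul_eq_mul, mul_assoc]
    rw [this]
    refine sum_le_sum fun a _ => ?_
    have hPa := hP a
    have e : 1 / 2 * (v a ^ 2 / P a) - 1 / 2 * ((N a - n * P a) ^ 2 / (n * P a)) =
        1 / 2 * ((v - y) a * (v + y) a) / P a := by
      rw [← hua]
      simp only [hy, PiLp.sub_apply, PiLp.add_apply, PiLp.smul_apply, smul_eq_mul]
      rw [hns]
      field_simp
      ring
    rw [e, abs_div, abs_of_pos hPa, abs_mul, abs_mul, abs_of_pos (by norm_num : (0 : ℝ) < 1 / 2)]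
    have b1 : |(v - y) a| ≤ ρ / s := (PiLp.norm_apply_le (v - y) a).trans hyv
    have b2 : |(v + y) a| ≤ 3 * R := (PiLp.norm_apply_le (v + y) a).trans hyv'
    calc 1 / 2 * (|(v - y) a| * |(v + y) a|) / P a ≤ 1 / 2 * (ρ / s * (3 * R)) / p := by
          gcongr
          exact hpP a
      _ = 3 / 2 * (ρ / p) * (R / s) := by field_simp
      _ ≤ 2 * (ρ / p) * (R ^ 3 / s) := by
          gcongr
          norm_num
      _ = _ := by ring
  set x := Real.log (typeWeight P n N) - (logNorm P n + -(1 / 2) * ∑ a, v a ^ 2 / P a) with hx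
  have hxle : |x| ≤ k * (2 / p + 4 / p ^ 2 + 2 * ρ / p) * (R ^ 3 / s) := by
    have e : x = (Real.log (typeWeight P n N) -
        (logNorm P n - 1 / 2 * ∑ a, (N a - n * P a) ^ 2 / (n * P a))) +
        (1 / 2 * ∑ a, v a ^ 2 / P a - 1 / 2 * ∑ a, (N a - n * P a) ^ 2 / (n * P a)) := by
      rw [hx]; ring
    rw [e]
    refine (abs_add_le _ _).trans ?_
    have e2 : k * (2 / p + 4 / p ^ 2 + 2 * ρ / p) * (R ^ 3 / s) =
        k * (2 / p + 4 / p ^ 2) * (R ^ 3 / s) + k * (2 * ρ / p) * (R ^ 3 / s) := by ring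
    linarith
  have hw : typeWeight P n N = Real.exp (logNorm P n) * gaussianKernel P v * Real.exp x := by
    rw [gaussianKernel, ← Real.exp_add, ← Real.exp_add, hx, add_sub_cancel,
      Real.exp_log (typeWeight_pos hP hN)]
  have hG : 0 < Real.exp (logNorm P n) * gaussianKernel P v :=
    mul_pos (Real.exp_pos _) (gaussianKernel_pos P v)
  rw [hw]
  have e3 : ∀ g : ℝ, g * Real.exp x - g = g * (Real.exp x - 1) := fun g => by ring
  rw [e3, abs_mul, abs_of_pos hG, mul_comm]
  gcongr
  exact (Real.abs_exp_sub_one_le (hxle.trans hsmall)).trans (by linarith)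

/-- Draws without replacement from a population close to `n P + √n v` are close to independent
draws from `P + v / √n`. -/
theorem abs_withoutReplacementProb_sub_iidProb_add_le {k n m : ℕ} (hn : 0 < n) (hmn : m ≤ n)
    {P : Vec k} {p : ℝ} (hp : 0 < p)
    (hpP : ∀ a, p ≤ P a) (hP1 : ∑ a, P a = 1) {N : Fin k → ℕ} (hN : ∑ a, N a = n)
    {v : Vec k} (hv0 : ∑ a, v a = 0) (hvpos : ∀ a, 0 < (P + (√n)⁻¹ • v) a) {R ρ : ℝ}
    (hu : ‖WithLp.toLp 2 (fun a => (N a : ℝ)) - (n : ℝ) • P‖ ≤ √n * R)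
    (hv : ‖√n • v - (WithLp.toLp 2 (fun a => (N a : ℝ)) - (n : ℝ) • P)‖ ≤ ρ)
    (hRn : 2 * (√n * R) ≤ p * n) (hm : (m : ℝ) ^ 2 ≤ n) (hmp : 4 * m ≤ p * n)
    (A : Set (Fin m → Fin k)) :
    |withoutReplacementProb hmn N A - iidProb (P + (√n)⁻¹ • v) m A| ≤
      (k + 1 + 8 / p ^ 2 + k * ρ) * (m / n) := by
  have hn' : (0 : ℝ) < n := by exact_mod_cast hn
  set s := √(n : ℝ) with hs
  have hs0 : 0 < s := Real.sqrt_pos.2 hn'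
  have hns : (n : ℝ) = s ^ 2 := (Real.sq_sqrt hn'.le).symm
  set u : Vec k := WithLp.toLp 2 (fun a => (N a : ℝ)) - (n : ℝ) • P with hudef
  have hua : ∀ a, u a = N a - n * P a := fun a => by simp [hudef]
  have hNbig : ∀ a, p / 2 * n ≤ N a := fun a => by
    have h1 : |u a| ≤ s * R := (PiLp.norm_apply_le u a).trans hu
    rw [hua] at h1
    have h2 := (abs_le.1 h1).1
    have h3 : p * n ≤ n * P a := by rw [mul_comm]; gcongr; exact hpP a
    linarith
  -- The counts are at least `(p/2) n`, whence `2/(p/2)² = 8/p²`.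
  have h1 := abs_withoutReplacementProb_sub_iidProb_le hmn hN hn (half_pos hp) hNbig hm
    (by linarith) A
  have h2 := abs_iidProb_sub_le (P := WithLp.toLp 2 fun a => (N a : ℝ) / n)
    (P' := P + s⁻¹ • v) (by
      have : ∑ a, (N a : ℝ) = n := by exact_mod_cast hN
      simp only [← sum_div, this]
      exact div_self hn'.ne') (fun a => by positivity)
    (by simp [sum_add_distrib, ← mul_sum, hP1, hv0]) (fun a => (hvpos a).le) m A
  -- The laws `N/n` and `P + v/√n` differ by an unscaled cell displacement divided by `n`.
  have h3 : ∑ a, |(WithLp.toLp 2 fun a => (N a : ℝ) / n : Vec k) a - (P + s⁻¹ • v) a| ≤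
      k * (ρ / n) := by
    have : (k : ℝ) * (ρ / n) = ∑ _a : Fin k, ρ / n := by simp
    rw [this]
    refine sum_le_sum fun a _ => ?_
    have e : (WithLp.toLp 2 fun a => (N a : ℝ) / n : Vec k) a - (P + s⁻¹ • v) a =
        -((s • v - u) a / n) := by
      simp only [PiLp.sub_apply, PiLp.add_apply, PiLp.smul_apply, smul_eq_mul, hua]
      rw [hns]
      field_simp
      ring
    rw [e, abs_neg, abs_div, abs_of_pos hn']
    gcongr
    exact (PiLp.norm_apply_le (s • v - u) a).trans hv
  have e1 : withoutReplacementProb hmn N A - iidProb (P + s⁻¹ • v) m A =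
      (withoutReplacementProb hmn N A - iidProb (WithLp.toLp 2 fun a => (N a : ℝ) / n) m A) +
      (iidProb (WithLp.toLp 2 fun a => (N a : ℝ) / n) m A - iidProb (P + s⁻¹ • v) m A) := by ring
  rw [e1]
  refine (abs_add_le _ _).trans ?_
  have h4 : (m : ℝ) * ∑ a, |(WithLp.toLp 2 fun a => (N a : ℝ) / n : Vec k) a - (P + s⁻¹ • v) a| ≤
      m * (k * (ρ / n)) := by gcongr
  have e2 : (k + 1 + 8 / p ^ 2 + k * ρ) * ((m : ℝ) / n) =
      (k + 1 + 2 / (p / 2) ^ 2) * (m / n) + m * (k * (ρ / n)) := by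
    field_simp
    ring
  linarith

/-! ### The cells of the type lattice -/

/-- The displacement of a type from `n P`, as an element of `T`. -/
def typeOffset {k : ℕ} (T : Submodule ℝ (Vec k)) (P : Vec k) (n : ℕ) (N : Fin k → ℕ) : T :=
  T.orthogonalProjectionOnto (WithLp.toLp 2 (fun a => (N a : ℝ)) - (n : ℝ) • P)

/-- The projection only makes `typeOffset` total; for a type the displacement is already in `T`. -/
theorem coe_typeOffset {k : ℕ} {T : Submodule ℝ (Vec k)} {P : Vec k} {n : ℕ} {N : Fin k → ℕ}
    (hN : N ∈ types T P n) : (typeOffset T P n N : Vec k) =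
      WithLp.toLp 2 (fun a => (N a : ℝ)) - (n : ℝ) • P :=
  Submodule.starProjection_eq_self_iff.2 (mem_types.1 hN).2.2

/-- The cell of the type `N` in the scaled type lattice. -/
def typeCell {k : ℕ} {ι : Type*} {T : Submodule ℝ (Vec k)} (b : Module.Basis ι ℝ T) (P : Vec k)
    (n : ℕ) (N : Fin k → ℕ) : Set T :=
  {v | √n • v - typeOffset T P n N ∈ ZSpan.fundamentalDomain b}

theorem measurableSet_typeCell {k : ℕ} {ι : Type*} [Finite ι] {T : Submodule ℝ (Vec k)}
    (b : Module.Basis ι ℝ T) (P : Vec k) (n : ℕ) (N : Fin k → ℕ) :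
    MeasurableSet (typeCell b P n N) :=
  (ZSpan.fundamentalDomain_measurableSet b).preimage (f := fun v : T =>
    √n • v - typeOffset T P n N) (by fun_prop)

theorem volume_real_typeCell {k : ℕ} {ι : Type*} {T : Submodule ℝ (Vec k)}
    (b : Module.Basis ι ℝ T) (P : Vec k) {n : ℕ} (hn : 0 < n) (N : Fin k → ℕ) :
    volume.real (typeCell b P n N) =
      ((√n : ℝ) ^ Module.finrank ℝ T)⁻¹ * volume.real (ZSpan.fundamentalDomain b) := by
  have hs : (0 : ℝ) < √n := Real.sqrt_pos.2 (by exact_mod_cast hn)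
  have e : typeCell b P n N =
      (√(n : ℝ) • ·) ⁻¹' ((· + -typeOffset T P n N) ⁻¹' (ZSpan.fundamentalDomain b)) := by
    ext v
    simp [typeCell, sub_eq_add_neg]
  rw [measureReal_def, e, Measure.addHaar_preimage_smul _ hs.ne', measure_preimage_add_right,
    ENNReal.toReal_mul, ENNReal.toReal_ofReal (abs_nonneg _), abs_of_nonneg (by positivity),
    measureReal_def]

/-- Offsets of two types differ by an integer vector, so the representatives of a common point in
the fundamental domain agree, and then so do the offsets. -/
theorem pairwiseDisjoint_typeCell {k : ℕ} {ι : Type*} [Fintype ι] {T : Submodule ℝ (Vec k)}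
    (b : Module.Basis ι ℝ T)
    (hb : ∀ v : T, v ∈ Submodule.span ℤ (Set.range b) ↔ ∀ x, ∃ z : ℤ, (v : Vec k) x = z)
    (P : Vec k) (n : ℕ) :
    (types T P n : Set (Fin k → ℕ)).PairwiseDisjoint (typeCell b P n) := by
  intro N hN N' hN' hne
  refine Set.disjoint_left.2 fun v hv hv' => hne ?_
  have hN := mem_coe.1 hN
  have hN' := mem_coe.1 hN'
  have h1 := (ZSpan.fract_eq_self (b := b)).2 hv
  have h2 := (ZSpan.fract_eq_self (b := b)).2 hv'
  have h3 : ZSpan.fract b (√n • v - typeOffset T P n N) =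
      ZSpan.fract b (√n • v - typeOffset T P n N') := by
    rw [ZSpan.fract_eq_fract, hb]
    intro x
    refine ⟨N x - N' x, ?_⟩
    simp only [Submodule.coe_add, Submodule.coe_neg, Submodule.coe_sub, coe_typeOffset hN,
      coe_typeOffset hN']
    simp
  rw [h1, h2, sub_right_inj] at h3
  have h4 := congrArg Subtype.val h3
  rw [coe_typeOffset hN, coe_typeOffset hN', sub_left_inj] at h4
  funext a
  have := congrArg (fun z : Vec k => z a) h4
  simpa using this

theorem norm_le_of_mem_typeCell {k : ℕ} {ι : Type*} [Fintype ι] {T : Submodule ℝ (Vec k)}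
    (b : Module.Basis ι ℝ T) {P : Vec k} {n : ℕ} {N : Fin k → ℕ} {v : T}
    (hv : v ∈ typeCell b P n N) : ‖√n • v - typeOffset T P n N‖ ≤ ∑ i, ‖b i‖ := by
  rw [← (ZSpan.fract_eq_self (b := b)).2 hv]
  exact ZSpan.norm_fract_le b _

/-- Every point of moderate size lies in the cell of a type of moderate size. -/
theorem exists_mem_typeCell {k : ℕ} {ι : Type*} [Fintype ι] {T : Submodule ℝ (Vec k)}
    (hT : ∀ v ∈ T, ∑ a, v a = 0) (b : Module.Basis ι ℝ T)
    (hb : ∀ v : T, v ∈ Submodule.span ℤ (Set.range b) ↔ ∀ x, ∃ z : ℤ, (v : Vec k) x = z)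
    {P : Vec k} {n : ℕ} (hn : 0 < n) {p : ℝ} (hp : 0 < p) (hpP : ∀ a, p ≤ P a)
    (hP1 : ∑ a, P a = 1)
    (hne : (types T P n).Nonempty) {R : ℝ} (hρ : ∑ i, ‖b i‖ ≤ √n) (hRn : 2 * (√n * R) ≤ p * n)
    {v : T} (hv : ‖v‖ ≤ R - 1) :
    ∃ N ∈ types T P n, ‖typeOffset T P n N‖ ≤ √n * R ∧ v ∈ typeCell b P n N := by
  have hn' : (0 : ℝ) < n := by exact_mod_cast hn
  obtain ⟨N₀, hN₀⟩ := hne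
  set s := √(n : ℝ) with hs
  have hs0 : 0 < s := Real.sqrt_pos.2 hn'
  set y : T := s • v - typeOffset T P n N₀ with hy
  -- Any existing type `N₀` serves as origin of the translated lattice; rounding relative to it
  -- gives the offset of the sought type.
  set w : T := typeOffset T P n N₀ + ZSpan.floor b y with hw
  have hwfr : s • v - w = ZSpan.fract b y := by
    rw [ZSpan.fract_apply, hw, hy]; abel
  have hwnorm : ‖w‖ ≤ s * R := by
    have e : w = s • v - ZSpan.fract b y := by rw [← hwfr]; abel
    rw [e]
    refine (norm_sub_le _ _).trans ?_
    rw [norm_smul, Real.norm_of_nonneg hs0.le]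
    have h1 := ZSpan.norm_fract_le b y
    have h2 : s * ‖v‖ ≤ s * (R - 1) := by gcongr
    linarith
  choose z hz using (hb _).1 (ZSpan.floor b y).2
  have hwa : ∀ a, (w : Vec k) a = (N₀ a : ℝ) - n * P a + z a := by
    intro a
    rw [← hz a, hw, Submodule.coe_add, coe_typeOffset hN₀]
    simp
  -- A lattice point is a type only if its counts are positive: `|w_a| ≤ √n R ≤ p n/2` keeps them at
  -- least `p n/2`.
  have hpos : ∀ a, 0 < (N₀ a : ℤ) + z a := by
    intro a
    have h1 : |(w : Vec k) a| ≤ s * R := (PiLp.norm_apply_le (w : Vec k) a).trans hwnorm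
    rw [hwa] at h1
    have h2 := (abs_le.1 h1).1
    have h3 : p * n ≤ n * P a := by rw [mul_comm]; gcongr; exact hpP a
    have h4 : 0 < p * n := by positivity
    have h5 : (0 : ℝ) < N₀ a + z a := by linarith
    exact_mod_cast h5
  set N : Fin k → ℕ := fun a => ((N₀ a : ℤ) + z a).toNat with hN
  have hNa : ∀ a, (N a : ℝ) = N₀ a + z a := by
    intro a
    have : ((N a : ℕ) : ℤ) = N₀ a + z a := Int.toNat_of_nonneg (hpos a).le
    exact_mod_cast this
  have hwN : WithLp.toLp 2 (fun a => (N a : ℝ)) - (n : ℝ) • P = w := by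
    ext a
    rw [hwa]
    simp only [PiLp.sub_apply, PiLp.smul_apply, smul_eq_mul, hNa]
    ring
  have hmem : N ∈ types T P n := by
    refine mem_types.2 ⟨?_, fun a => ?_, by rw [hwN]; exact w.2⟩
    · have h1 := hT _ w.2
      simp only [hwa, sum_add_distrib, sum_sub_distrib, ← mul_sum, hP1, mul_one] at h1
      have h2 : ∑ a, (N a : ℝ) = n := by
        simp only [hNa, sum_add_distrib]
        linarith
      exact_mod_cast h2
    · have := hpos a
      simp only [hN]
      omega
  have hoff : typeOffset T P n N = w := Subtype.ext ((coe_typeOffset hmem).trans hwN)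
  refine ⟨N, hmem, by rw [hoff]; exact hwnorm, ?_⟩
  rw [typeCell, Set.mem_ofPred_eq, hoff, hwfr]
  exact ZSpan.fract_mem_fundamentalDomain b y

/-- On central cells the metric projection therefore does nothing, and the chart is affine there. -/
theorem add_inv_sqrt_smul_pos {k n : ℕ} (hn : 0 < n) {P u v : Vec k} {p : ℝ} (hp : 0 < p)
    (hpP : ∀ a, p ≤ P a) {R ρ : ℝ} (hR : 1 ≤ R) (hu : ‖u‖ ≤ √n * R) (hv : ‖√n • v - u‖ ≤ ρ)
    (hρ : ρ ≤ √n) (hRn : 4 * (√n * R) ≤ p * n) (a : Fin k) : 0 < (P + (√n)⁻¹ • v) a := by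
  have hn' : (0 : ℝ) < n := by exact_mod_cast hn
  set s := √(n : ℝ) with hs
  have hs0 : 0 < s := Real.sqrt_pos.2 hn'
  have hns : (n : ℝ) = s ^ 2 := (Real.sq_sqrt hn'.le).symm
  have h1 : ‖s • v‖ ≤ s * R + ρ := by
    have e : s • v = u + (s • v - u) := by abel
    rw [e]
    exact (norm_add_le _ _).trans (add_le_add hu hv)
  have h2 : s * |v a| ≤ s * R + ρ := by
    have := (PiLp.norm_apply_le (s • v) a).trans h1
    rwa [PiLp.smul_apply, norm_smul, Real.norm_of_nonneg hs0.le] at this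
  have h3 : s ≤ s * R := le_mul_of_one_le_right hs0.le hR
  have h5 : |v a| ≤ s * (p / 2) := by
    refine le_of_mul_le_mul_left ?_ hs0
    have e : s * (s * (p / 2)) = p * n / 2 := by rw [hns]; ring
    rw [e]
    linarith
  have h6 : |s⁻¹ * v a| ≤ p / 2 := by
    rw [abs_mul, abs_inv, abs_of_pos hs0, inv_mul_le_iff₀ hs0]
    exact h5
  simp only [PiLp.add_apply, PiLp.smul_apply, smul_eq_mul]
  linarith [hpP a, (abs_le.1 h6).1]

/-! ### Tails, and the comparison for fixed `n` -/

/-- The total weight of the types far from `n P`. -/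
theorem sum_typeWeight_le_of_far {k n : ℕ} (hn : 0 < n) {T : Submodule ℝ (Vec k)} {P : Vec k}
    {p : ℝ} (hp : 0 < p) (hpP : ∀ a, p ≤ P a) (hP1 : ∑ a, P a = 1) {R : ℝ} (hR : 0 ≤ R)
    {t : Finset (Fin k → ℕ)} (ht : t ⊆ types T P n)
    (hfar : ∀ N ∈ t, √n * R ≤ ‖typeOffset T P n N‖) :
    ∑ N ∈ t, typeWeight P n N ≤ (n + 1) ^ k * (Real.exp (logNorm P n) *
      Real.exp (k / 2 * Real.log n - p / 4 * R ^ 2)) := by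
  have hn' : (0 : ℝ) < n := by exact_mod_cast hn
  have hone : ∀ N ∈ t, typeWeight P n N ≤ Real.exp (logNorm P n) *
      Real.exp (k / 2 * Real.log n - p / 4 * R ^ 2) := by
    intro N hN
    have hN1 := ht hN
    refine (typeWeight_le hn hp hpP hP1 (mem_types.1 hN1).1 (mem_types.1 hN1).2.1).trans ?_
    gcongr
    have h1 : ∑ a, ((N a : ℝ) - n * P a) ^ 2 / n = ‖typeOffset T P n N‖ ^ 2 / n := by
      rw [← Submodule.norm_coe, coe_typeOffset hN1, EuclideanSpace.real_norm_sq_eq, sum_div]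
      simp
    rw [h1, le_div_iff₀ hn']
    calc R ^ 2 * n = (√n * R) ^ 2 := by rw [mul_pow, Real.sq_sqrt hn'.le, mul_comm]
      _ ≤ _ := by
        have := hfar N hN
        gcongr
  refine (sum_le_card_nsmul _ _ _ hone).trans ?_
  rw [nsmul_eq_mul]
  gcongr
  exact_mod_cast (card_le_card ht).trans (card_types_le T P n)

/-- The Gaussian mass of a set far from the origin. -/
theorem setIntegral_gaussianKernel_le_of_far {k : ℕ} {P : Vec k} (hP : ∀ a, 0 < P a)
    (hP1 : ∀ a, P a ≤ 1) {T : Submodule ℝ (Vec k)} {U : Set T} (hU : MeasurableSet U) {r : ℝ}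
    (hr : 0 ≤ r) (hfar : ∀ v ∈ U, r ≤ ‖v‖) :
    ∫ v in U, gaussianKernel P v ≤
      Real.exp (-(1 / 4) * r ^ 2) * ∫ v : T, Real.exp (-(1 / 4) * ‖v‖ ^ 2) := by
  have hJint := integrable_exp_neg_mul_sq_norm T (c := 1 / 4) (by norm_num)
  -- Half of the exponent pays for the distance `r`; the other half remains integrable.
  have h1 : ∫ v in U, gaussianKernel P v ≤ ∫ v in U, Real.exp (-(1 / 4) * r ^ 2) *
      Real.exp (-(1 / 4) * ‖v‖ ^ 2) := by
    refine setIntegral_mono_on (integrable_gaussianKernel hP hP1 T).integrableOn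
      (hJint.integrableOn.const_mul _) hU fun v hv => ?_
    refine (gaussianKernel_le hP hP1 v).trans ?_
    rw [← Real.exp_add, Real.exp_le_exp, Submodule.norm_coe]
    have : r ^ 2 ≤ ‖v‖ ^ 2 := by
      have := hfar v hv
      gcongr
    linarith
  rw [integral_const_mul] at h1
  refine h1.trans (mul_le_mul_of_nonneg_left ?_ (Real.exp_pos _).le)
  exact setIntegral_le_integral hJint (Filter.Eventually.of_forall fun v => (Real.exp_pos _).le)

set_option maxHeartbeats 400000 in
/-- The comparison of the two averages for a fixed sample size. -/
theorem abs_average_types_sub_le {k : ℕ} {ι : Type*} [Fintype ι] {T : Submodule ℝ (Vec k)}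
    (hT : ∀ v ∈ T, ∑ a, v a = 0) (b : Module.Basis ι ℝ T)
    (hb : ∀ v : T, v ∈ Submodule.span ℤ (Set.range b) ↔ ∀ x, ∃ z : ℤ, (v : Vec k) x = z)
    {P : Vec k} {p : ℝ} (hp : 0 < p) (hpP : ∀ a, p ≤ P a) (hP1 : ∑ a, P a = 1)
    {n m : ℕ} (hn : 0 < n) (hmn : m ≤ n) (hne : (types T P n).Nonempty) {R ρ : ℝ} (hR : 1 ≤ R)
    (hρb : ∑ i, ‖b i‖ = ρ) (hρ : ρ ≤ √n) (hRn : 4 * (√n * R) ≤ p * n)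
    (hm : (m : ℝ) ^ 2 ≤ n) (hmp : 4 * m ≤ p * n)
    (hsmall : k * (2 / p + 4 / p ^ 2 + 2 * ρ / p) * (R ^ 3 / √n) ≤ 1)
    (htail₁ : volume.real (ZSpan.fundamentalDomain b) *
      ((n + 1) ^ k * Real.exp (k / 2 * Real.log n - p / 4 * R ^ 2)) ≤
      (√n)⁻¹ * ∫ v : T, Real.exp (-(1 / (2 * p)) * ‖v‖ ^ 2))
    (htail₂ : Real.exp (-(1 / 4) * (R - 1) ^ 2) * ∫ v : T, Real.exp (-(1 / 4) * ‖v‖ ^ 2) ≤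
      (√n)⁻¹ * ∫ v : T, Real.exp (-(1 / (2 * p)) * ‖v‖ ^ 2))
    (A : Set (Fin m → Fin k)) {π : T → ℝ} (hπ : Continuous π) (hπ0 : ∀ v, 0 ≤ π v)
    (hπ1 : ∀ v, π v ≤ 1)
    (hπA : ∀ v : T, (∀ a, 0 < (P + (√n)⁻¹ • (v : Vec k)) a) →
      π v = iidProb (P + (√n)⁻¹ • (v : Vec k)) m A) :
    |(∑ N ∈ types T P n, typeWeight P n N * withoutReplacementProb hmn N A) /
        ∑ N ∈ types T P n, typeWeight P n N -
      (∫ v : T, gaussianKernel P v)⁻¹ * ∫ v : T, π v * gaussianKernel P v| ≤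
      8 * ((2 * (k * (2 / p + 4 / p ^ 2 + 2 * ρ / p)) + (k + 1 + 8 / p ^ 2 + k * ρ) + 1) *
        (R ^ 3 / √n)) := by
  classical
  have hn' : (0 : ℝ) < n := by exact_mod_cast hn
  have hP : ∀ a, 0 < P a := fun a => hp.trans_le (hpP a)
  have hPle : ∀ a, P a ≤ 1 := fun a => by
    rw [← hP1]
    exact single_le_sum (f := fun a => P a) (fun b _ => (hP b).le) (mem_univ a)
  set s := √(n : ℝ) with hs
  have hs0 : 0 < s := Real.sqrt_pos.2 hn'
  have hs1 : 1 ≤ s := by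
    rw [hs, Real.one_le_sqrt]
    exact_mod_cast hn
  have hns : (n : ℝ) = s ^ 2 := (Real.sq_sqrt hn'.le).symm
  have hρ0 : 0 ≤ ρ := hρb ▸ sum_nonneg fun i _ => norm_nonneg _
  have hsR : 0 ≤ s * R := by positivity
  have hRn2 : 2 * (s * R) ≤ p * n := by linarith
  have hR31 : 1 ≤ R ^ 3 := one_le_pow₀ hR
  set c₁ := k * (2 / p + 4 / p ^ 2 + 2 * ρ / p) with hc₁
  set c₂ := k + 1 + 8 / p ^ 2 + k * ρ with hc₂
  have hc₁0 : 0 ≤ c₁ := by positivity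
  have hc₂0 : 0 ≤ c₂ := by positivity
  -- One common error: `2 c₁` covers the weights, `c₂` the values, and `1` the two tails.
  set ε := (2 * c₁ + c₂ + 1) * (R ^ 3 / s) with hε
  have hRs : 0 ≤ R ^ 3 / s := by positivity
  have hε0 : 0 ≤ ε := by positivity
  have hε1 : 2 * (c₁ * (R ^ 3 / s)) ≤ ε := by rw [hε]; nlinarith
  have hε2 : c₂ * (m / n) ≤ ε := by
    have : (m : ℝ) / n ≤ R ^ 3 / s := by
      have hms : (m : ℝ) ≤ s := by
        rw [hs]; exact Real.le_sqrt_of_sq_le hm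
      rw [hns, div_le_div_iff₀ (by positivity) hs0]
      nlinarith
    calc c₂ * (m / n) ≤ c₂ * (R ^ 3 / s) := by gcongr
      _ ≤ ε := by rw [hε]; nlinarith
  have hε3 : s⁻¹ ≤ ε := by
    calc s⁻¹ = 1 * (1 / s) := by simp
      _ ≤ (2 * c₁ + c₂ + 1) * (R ^ 3 / s) := by gcongr; linarith
  set t := (types T P n).filter fun N => ‖typeOffset T P n N‖ ≤ s * R with ht
  have hts : t ⊆ types T P n := filter_subset _ _
  have hGint := integrable_gaussianKernel hP hPle T
  have hI0 : 0 < ∫ v : T, Real.exp (-(1 / (2 * p)) * ‖v‖ ^ 2) := by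
    rw [GaussianFourier.integral_rexp_neg_mul_sq_norm (by positivity)]
    positivity
  have hII0 : ∫ v : T, Real.exp (-(1 / (2 * p)) * ‖v‖ ^ 2) ≤ ∫ v : T, gaussianKernel P v :=
    integral_mono (integrable_exp_neg_mul_sq_norm T (by positivity)) hGint
      fun v => le_gaussianKernel hp hpP v
  have hVF : 0 < volume.real (ZSpan.fundamentalDomain b) := by
    rw [measureReal_def, ENNReal.toReal_pos_iff]
    exact ⟨pos_iff_ne_zero.2 (ZSpan.measure_fundamentalDomain_ne_zero b),
      (ZSpan.fundamentalDomain_isBounded b).measure_lt_top⟩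
  have hcellnorm : ∀ N ∈ t, ∀ v ∈ typeCell b P n N,
      ‖s • (v : Vec k) - (WithLp.toLp 2 (fun a => (N a : ℝ)) - (n : ℝ) • P)‖ ≤ ρ := by
    intro N hN v hv
    rw [← coe_typeOffset (hts hN), ← hρb]
    exact norm_le_of_mem_typeCell b hv
  have htnorm : ∀ N ∈ t, ‖WithLp.toLp 2 (fun a => (N a : ℝ)) - (n : ℝ) • P‖ ≤ s * R := by
    intro N hN
    rw [← coe_typeOffset (hts hN)]
    exact (mem_filter.1 hN).2
  refine abs_average_sub_average_le (μ := volume) (t := t) (D := typeCell b P n)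
    (G := fun v : T => gaussianKernel P v) (π := π) (c := Real.exp (logNorm P n)) (ε := ε)
    (V := (s ^ Module.finrank ℝ T)⁻¹ * volume.real (ZSpan.fundamentalDomain b)) hts
    (fun N hN => typeWeight_pos hP (mem_types.1 hN).1) hne
    (fun N => withoutReplacementProb_nonneg hmn N A)
    (fun N => withoutReplacementProb_le_one hmn N A)
    (fun N _ => measurableSet_typeCell b P n N)
    ((pairwiseDisjoint_typeCell b hb P n).subset (by exact_mod_cast hts)) (by positivity)
    (fun N _ => volume_real_typeCell b P hn N) hGint (fun v => (gaussianKernel_pos P v).le)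
    (hI0.trans_le hII0) hπ.aestronglyMeasurable hπ0 hπ1 (Real.exp_pos _) hε0 ?_ ?_ ?_ ?_
  · intro N hN v hv
    refine (abs_typeWeight_sub_le hn hp hpP hP1 (mem_types.1 (hts hN)).1 hR (htnorm N hN)
      (hcellnorm N hN v hv) hρ hRn2 hsmall).trans ?_
    have := gaussianKernel_pos P v
    gcongr
  · intro N hN v hv
    have hvpos := add_inv_sqrt_smul_pos hn hp hpP hR (htnorm N hN) (hcellnorm N hN v hv) hρ hRn
    rw [hπA v hvpos]
    exact (abs_withoutReplacementProb_sub_iidProb_add_le hn hmn hp hpP hP1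
      (mem_types.1 (hts hN)).1 (hT v v.2) hvpos (htnorm N hN) (hcellnorm N hN v hv) hRn2 hm hmp
      A).trans hε2
  · have hbad := sum_typeWeight_le_of_far hn hp hpP hP1 (zero_le_one.trans hR)
      (t := types T P n \ t) sdiff_subset fun N hN => by
        by_contra h
        exact (mem_sdiff.1 hN).2 (mem_filter.2 ⟨(mem_sdiff.1 hN).1, (not_le.1 h).le⟩)
    -- The gain from the small cell volume is dropped; the tail is small enough without it.
    have hV : (s ^ Module.finrank ℝ T)⁻¹ * volume.real (ZSpan.fundamentalDomain b) ≤
        volume.real (ZSpan.fundamentalDomain b) :=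
      mul_le_of_le_one_left hVF.le (inv_le_one_of_one_le₀ (one_le_pow₀ hs1))
    have hbad0 : 0 ≤ ∑ N ∈ types T P n \ t, typeWeight P n N :=
      sum_nonneg fun N hN => (typeWeight_pos hP (mem_types.1 (mem_sdiff.1 hN).1).1).le
    calc _ ≤ volume.real (ZSpan.fundamentalDomain b) * ((n + 1) ^ k * (Real.exp (logNorm P n) *
          Real.exp (k / 2 * Real.log n - p / 4 * R ^ 2))) :=
          mul_le_mul hV hbad hbad0 hVF.le
      _ = Real.exp (logNorm P n) * (volume.real (ZSpan.fundamentalDomain b) * ((n + 1) ^ k *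
          Real.exp (k / 2 * Real.log n - p / 4 * R ^ 2))) := by ring
      _ ≤ Real.exp (logNorm P n) * (ε * ∫ v : T, gaussianKernel P v) := by
          refine mul_le_mul_of_nonneg_left ?_ (Real.exp_pos _).le
          exact htail₁.trans (mul_le_mul hε3 hII0 hI0.le hε0)
      _ = _ := by ring
  · have hUm : MeasurableSet (⋃ N ∈ t, typeCell b P n N) :=
      t.measurableSet_biUnion fun N _ => measurableSet_typeCell b P n N
    refine (setIntegral_gaussianKernel_le_of_far hP hPle hUm.compl (sub_nonneg.2 hR)
      fun v hv => ?_).trans (htail₂.trans (mul_le_mul hε3 hII0 hI0.le hε0))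
    -- An uncovered point has norm at least `R - 1`: otherwise `exists_mem_typeCell` puts it in a
    -- central cell.
    by_contra h
    obtain ⟨N, hN1, hN2, hN3⟩ := exists_mem_typeCell hT b hb hn hp hpP hP1 hne
      (hρb.trans_le hρ) hRn2 (not_le.1 h).le
    exact hv (Set.mem_biUnion (mem_filter.2 ⟨hN1, hN2⟩) hN3)

/-! ### The choice `R = log n` and uniformity in `P` -/

open Filter Topology in
theorem tendsto_log_pow_div_sqrt (j : ℕ) :
    Tendsto (fun n : ℕ => Real.log n ^ j / √(n : ℝ)) atTop (𝓝 0) := by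
  have h := (isLittleO_log_rpow_rpow_atTop (j : ℝ)
    (by norm_num : (0 : ℝ) < 1 / 2)).tendsto_div_nhds_zero
  refine (h.comp tendsto_natCast_atTop_atTop).congr fun n => ?_
  simp [Real.sqrt_eq_rpow]

-- A Gaussian tail at radius `log n` beats every power of `n`.
open Filter Topology in
theorem tendsto_exp_sub_mul_log_sq {a : ℝ} (ha : 0 < a) (c d : ℝ) :
    Tendsto (fun n : ℕ => Real.exp (c * Real.log n + d - a * Real.log n ^ 2)) atTop (𝓝 0) := by
  refine Real.tendsto_exp_atBot.comp ?_
  have hlog : Tendsto (fun n : ℕ => Real.log n) atTop atTop :=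
    Real.tendsto_log_atTop.comp tendsto_natCast_atTop_atTop
  refine Tendsto.comp (g := fun x : ℝ => c * x + d - a * x ^ 2) ?_ hlog
  have h1 : Tendsto (fun x : ℝ => x * (a * x - c)) atTop atTop :=
    tendsto_id.atTop_mul_atTop₀ (tendsto_atTop_add_const_right _ _ (tendsto_id.const_mul_atTop ha))
  have h2 : Tendsto (fun x : ℝ => d + -(x * (a * x - c))) atTop atBot :=
    tendsto_atBot_add_const_left _ _ (tendsto_neg_atTop_atBot.comp h1)
  refine h2.congr fun x => ?_
  ring

-- The growth condition on `m` is used only through the resulting bound `m ≤ √n`.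
open Filter Topology in
theorem eventually_mul_rpow_le_sqrt {η : ℝ} (hη : η < 1 / 2) (K : ℝ) :
    ∀ᶠ n : ℕ in atTop, K * (n : ℝ) ^ η ≤ √(n : ℝ) := by
  have h := ((tendsto_rpow_neg_atTop (sub_pos.2 hη)).comp
    (tendsto_natCast_atTop_atTop (R := ℝ))).const_mul K
  rw [mul_zero] at h
  filter_upwards [h.eventually (ge_mem_nhds zero_lt_one), eventually_gt_atTop 0] with n hn hn0
  have hn' : (0 : ℝ) < n := by exact_mod_cast hn0
  have e : K * (n : ℝ) ^ η = K * (n : ℝ) ^ (-(1 / 2 - η)) * √(n : ℝ) := by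
    rw [Real.sqrt_eq_rpow, mul_assoc, ← Real.rpow_add hn']
    congr 2
    ring
  rw [e]
  exact mul_le_of_le_one_left (Real.sqrt_nonneg _) hn

open Filter Topology in
/-- The comparison of the two averages, uniformly over all laws bounded below by `p`. -/
theorem exists_average_types_bound {k : ℕ} (T : Submodule ℝ (Vec k))
    (hT : ∀ v ∈ T, ∑ a, v a = 0)
    (hspan : Submodule.span ℝ {v : Vec k | v ∈ T ∧ ∀ x, ∃ z : ℤ, v x = z} = T)
    {p : ℝ} (hp : 0 < p) :
    ∃ C : ℝ, ∀ η K : ℝ, η < 1 / 2 → ∃ n₀ : ℕ, ∀ P : Vec k, (∀ a, p ≤ P a) → ∑ a, P a = 1 →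
      ∀ (n m : ℕ) (hmn : m ≤ n), n₀ ≤ n → (m : ℝ) ≤ K * (n : ℝ) ^ η → (types T P n).Nonempty →
      ∀ (A : Set (Fin m → Fin k)) (π : T → ℝ), Continuous π → (∀ v, 0 ≤ π v) → (∀ v, π v ≤ 1) →
      (∀ v : T, (∀ a, 0 < (P + (√n)⁻¹ • (v : Vec k)) a) →
        π v = iidProb (P + (√n)⁻¹ • (v : Vec k)) m A) →
      |(∑ N ∈ types T P n, typeWeight P n N * withoutReplacementProb hmn N A) /
          ∑ N ∈ types T P n, typeWeight P n N -
        (∫ v : T, gaussianKernel P v)⁻¹ * ∫ v : T, π v * gaussianKernel P v| ≤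
        C * (n : ℝ) ^ (-(1 / 2) : ℝ) * Real.log n ^ 3 := by
  obtain ⟨ι, _, b, hb⟩ := exists_basis_integer_span T hspan
  obtain ⟨ρ, hρb⟩ : ∃ ρ, ∑ i, ‖b i‖ = ρ := ⟨_, rfl⟩
  set c₁ := k * (2 / p + 4 / p ^ 2 + 2 * ρ / p) with hc₁
  refine ⟨8 * (2 * c₁ + (k + 1 + 8 / p ^ 2 + k * ρ) + 1), fun η K hη => ?_⟩
  have hI0 : 0 < ∫ v : T, Real.exp (-(1 / (2 * p)) * ‖v‖ ^ 2) := by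
    rw [GaussianFourier.integral_rexp_neg_mul_sq_norm (by positivity)]
    positivity
  set I₀ := ∫ v : T, Real.exp (-(1 / (2 * p)) * ‖v‖ ^ 2) with hI₀
  set J₀ := ∫ v : T, Real.exp (-(1 / 4) * ‖v‖ ^ 2) with hJ₀
  set V₀ := volume.real (ZSpan.fundamentalDomain b) with hV₀
  have hV₀0 : 0 ≤ V₀ := measureReal_nonneg
  have hlog : Tendsto (fun n : ℕ => Real.log n) atTop atTop :=
    Real.tendsto_log_atTop.comp tendsto_natCast_atTop_atTop
  have hsqrt : Tendsto (fun n : ℕ => √(n : ℝ)) atTop atTop :=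
    Real.tendsto_sqrt_atTop.comp tendsto_natCast_atTop_atTop
  have hp4 : 0 < p / 4 := by positivity
  have E1 : ∀ᶠ n : ℕ in atTop, c₁ * (Real.log n ^ 3 / √(n : ℝ)) ≤ 1 := by
    have := (tendsto_log_pow_div_sqrt 3).const_mul c₁
    rw [mul_zero] at this
    exact this.eventually (ge_mem_nhds zero_lt_one)
  have E2 : ∀ᶠ n : ℕ in atTop, 4 * (Real.log n ^ 1 / √(n : ℝ)) ≤ p := by
    have := (tendsto_log_pow_div_sqrt 1).const_mul 4
    rw [mul_zero] at this
    exact this.eventually (ge_mem_nhds hp)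
  -- The exponent collects `n^k` from the number of types, `n^{k/2}` from `typeWeight_le` and `√n`
  -- from the target rate; `2^k` comes from `(n+1)^k ≤ 2^k n^k`.
  have E3 : ∀ᶠ n : ℕ in atTop, V₀ * 2 ^ k *
      Real.exp ((k + k / 2 + 1 / 2) * Real.log n + 0 - p / 4 * Real.log n ^ 2) ≤ I₀ := by
    have := (tendsto_exp_sub_mul_log_sq hp4 (k + k / 2 + 1 / 2) 0).const_mul (V₀ * 2 ^ k)
    rw [mul_zero] at this
    exact this.eventually (ge_mem_nhds hI0)
  -- With `ℓ = log n`, the exponent is `-(ℓ - 1)²/4 + ℓ/2`, the last term being `log √n`.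
  have E4 : ∀ᶠ n : ℕ in atTop, J₀ *
      Real.exp (1 * Real.log n + -(1 / 4) - 1 / 4 * Real.log n ^ 2) ≤ I₀ := by
    have := (tendsto_exp_sub_mul_log_sq (by norm_num : (0 : ℝ) < 1 / 4) 1 (-(1 / 4))).const_mul J₀
    rw [mul_zero] at this
    exact this.eventually (ge_mem_nhds hI0)
  -- None of these conditions involves `P`, so `n₀` is uniform over all laws bounded below by `p`.
  obtain ⟨n₀, hn₀⟩ := eventually_atTop.1 (E1.and (E2.and (E3.and (E4.and
    ((eventually_mul_rpow_le_sqrt hη K).and ((hlog.eventually_ge_atTop 1).and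
    ((hsqrt.eventually_ge_atTop ρ).and (eventually_gt_atTop 0))))))))
  refine ⟨n₀, fun P hpP hP1 n m hmn hn hmK hne A π hπ hπ0 hπ1 hπA => ?_⟩
  obtain ⟨h1, h2, h3, h4, h5, hR, hρ, hnpos⟩ := hn₀ n hn
  have hn' : (0 : ℝ) < n := by exact_mod_cast hnpos
  have hs0 : 0 < √(n : ℝ) := Real.sqrt_pos.2 hn'
  have hs1 : 1 ≤ √(n : ℝ) := by
    rw [Real.one_le_sqrt]
    exact_mod_cast hnpos
  have hns : √(n : ℝ) ^ 2 = n := Real.sq_sqrt hn'.le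
  have hms : (m : ℝ) ≤ √(n : ℝ) := hmK.trans h5
  have hRn : 4 * (√(n : ℝ) * Real.log n) ≤ p * n := by
    rw [pow_one, ← mul_div_assoc, div_le_iff₀ hs0] at h2
    have h6 := mul_le_mul_of_nonneg_left h2 hs0.le
    have h7 : p * n = √(n : ℝ) * (p * √(n : ℝ)) := by
      rw [mul_left_comm, ← sq, hns]
    linarith
  have hsexp : √(n : ℝ) = Real.exp (1 / 2 * Real.log n) := by
    rw [mul_comm, Real.exp_mul, Real.exp_log hn', Real.sqrt_eq_rpow]
  have key := abs_average_types_sub_le hT b hb hp hpP hP1 hnpos hmn hne hR hρb hρ hRn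
    (by rw [← hns]; gcongr) (by nlinarith) h1 ?_ ?_ A hπ hπ0 hπ1 hπA
  · refine key.trans (le_of_eq ?_)
    rw [Real.rpow_neg hn'.le, ← Real.sqrt_eq_rpow]
    ring
  · rw [le_inv_mul_iff₀ hs0]
    refine le_trans ?_ h3
    have h6 : ((n : ℝ) + 1) ^ k ≤ 2 ^ k * Real.exp (k * Real.log n) := by
      rw [Real.exp_nat_mul, Real.exp_log hn', ← mul_pow]
      have : (1 : ℝ) ≤ n := by exact_mod_cast hnpos
      gcongr
      linarith
    calc √(n : ℝ) * (V₀ * (((n : ℝ) + 1) ^ k *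
          Real.exp (k / 2 * Real.log n - p / 4 * Real.log n ^ 2)))
        ≤ √(n : ℝ) * (V₀ * (2 ^ k * Real.exp (k * Real.log n) *
          Real.exp (k / 2 * Real.log n - p / 4 * Real.log n ^ 2))) := by gcongr
      _ = V₀ * 2 ^ k * (Real.exp (1 / 2 * Real.log n) * Real.exp (k * Real.log n) *
          Real.exp (k / 2 * Real.log n - p / 4 * Real.log n ^ 2)) := by rw [hsexp]; ring
      _ = _ := by
          rw [← Real.exp_add, ← Real.exp_add]
          congr 2
          ring
  · rw [le_inv_mul_iff₀ hs0]
    refine le_trans (le_of_eq ?_) h4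
    rw [hsexp, ← mul_assoc, ← Real.exp_add, mul_comm]
    congr 2
    ring

/-- `H*` is positive definite on `T*`, hence maps it onto itself. Thus the matrix `H*` determines
`T*`, and constants built from `T*` depend on `H*` only. -/
theorem tangentSpace_eq_range_projectedHessian {k d : ℕ} (h : Fin k → Fin d → ℝ) {P : Vec k}
    (hP : ∀ a, 0 < P a) : tangentSpace h = LinearMap.range (projectedHessian h P) := by
  apply le_antisymm
  · intro v hv
    have hinj : Function.Injective (tangentHessian h P) := by
      rw [injective_iff_map_eq_zero]
      intro w hw
      have h1 := inner_tangentHessian h P w w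
      rw [hw, inner_zero_right] at h1
      have h2 := (sum_eq_zero_iff_of_nonneg fun a _ =>
        div_nonneg (mul_self_nonneg (w.1 a)) (hP a).le).1 h1.symm
      ext a
      have h3 := h2 a (mem_univ a)
      rw [div_eq_zero_iff, or_iff_left (hP a).ne', mul_self_eq_zero] at h3
      simpa using h3
    obtain ⟨w, hw⟩ := LinearMap.injective_iff_surjective.1 hinj ⟨v, hv⟩
    exact ⟨w, congrArg Subtype.val hw⟩
  · rintro _ ⟨w, rfl⟩
    exact projectedHessian_mem h P w

end TiltedDeFinetti

end

/-! ### The theorem -/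

open TiltedDeFinetti in
theorem theorem1 (k d : ℕ) (hk : 2 ≤ k) (pmin : ℝ) (H : Vec k →ₗ[ℝ] Vec k) :
    ∃ (C : ℝ) (L : ℕ), ∀ (η K : ℝ), η < 1 / 2 → ∃ n₀ : ℕ,
      ∀ (Q : Vec k) (h : Fin k → Fin d → ℝ) (α : Fin d → ℝ) (Pstar : Vec k),
        Q ∈ openSimplex k →
        HasFullTypeLattice h →
        IsIProjection Q h α Pstar →
        IsLeast (Set.range fun x => Pstar x) pmin →
        projectedHessian h Pstar = H →
        ∀ (n m : ℕ) (hmn : m ≤ n), n₀ ≤ n → (m : ℝ) ≤ K * (n : ℝ) ^ η →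
          (constraintEvent h α n).Nonempty →
          ∀ A : Set (Fin m → Fin k),
            MeasureTheory.Integrable
              (fun v : tangentSpace h =>
                iidProb (localChart h α Pstar n v) m A * gaussianDensity h Pstar v)
              (tangentLebesgue h) ∧
            |predictiveLaw Q h α hmn A -
                ∫ v : tangentSpace h,
                  iidProb (localChart h α Pstar n v) m A * gaussianDensity h Pstar v
                  ∂(tangentLebesgue h)| ≤
              C * (n : ℝ) ^ (-(1 / 2) : ℝ) * Real.log n ^ L := by
  -- The constants must be chosen before `h` is known; the tangent space is read off from `H`.
  obtain ⟨T, hTH⟩ : ∃ T, LinearMap.range H = T := ⟨_, rfl⟩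
  by_cases hyp : 0 < pmin ∧ (∀ v ∈ T, ∑ a, v a = 0) ∧
    Submodule.span ℝ {v : Vec k | v ∈ T ∧ ∀ x, ∃ z : ℤ, v x = z} = T
  swap
  -- If `pmin` and `H` violate these conditions, no admissible data give rise to them and the claim
  -- is vacuous.
  · refine ⟨0, 0, fun η K _ => ⟨0, fun Q h α Pstar _ hfull hproj hmin hH => absurd ?_ hyp⟩⟩
    have hT : tangentSpace h = T := by
      rw [← hTH, ← hH]
      exact tangentSpace_eq_range_projectedHessian h hproj.1.1.1
    subst hT
    obtain ⟨x, hx⟩ := hmin.1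
    exact ⟨hx ▸ hproj.1.1.1 x, fun v hv => hv.1, hfull⟩
  obtain ⟨hp, hT0, hspan⟩ := hyp
  obtain ⟨C, hC⟩ := exists_average_types_bound T hT0 hspan hp
  refine ⟨C, 3, fun η K hη => ?_⟩
  obtain ⟨n₀, hn₀⟩ := hC η K hη
  -- The sample size must be positive for counts and empirical laws to correspond.
  refine ⟨max n₀ 1, fun Q h α Pstar hQ hfull hproj hmin hH n m hmn hn hmK hne A => ?_⟩
  have hpos : ∀ a, 0 < Pstar a := hproj.1.1.1
  have hn1 : 0 < n := le_of_max_le_right hn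
  have hT : tangentSpace h = T := by
    rw [← hTH, ← hH]
    exact tangentSpace_eq_range_projectedHessian h hpos
  clear hC
  subst hT
  have hle : ∀ a, Pstar a ≤ 1 := fun a => by
    rw [← hproj.1.1.2]
    exact Finset.single_le_sum (f := fun a => Pstar a) (fun b _ => (hpos b).le)
      (Finset.mem_univ a)
  have hcont := continuous_iidProb_localChart hproj.1 n m A
  have hnn : ∀ v, 0 ≤ iidProb (localChart h α Pstar n v) m A :=
    fun v => iidProb_nonneg (localChart_mem hproj.1 n v).1 m A
  have hle1 : ∀ v, iidProb (localChart h α Pstar n v) m A ≤ 1 := fun v =>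
    iidProb_le_one (localChart_mem hproj.1 n v).2.1 (localChart_mem hproj.1 n v).1 m A
  have hG := integrable_gaussianKernel hpos hle (tangentSpace h)
  have e : ∀ v : tangentSpace h,
      iidProb (localChart h α Pstar n v) m A * gaussianDensity h Pstar v =
      (∫ w : tangentSpace h, gaussianKernel Pstar w)⁻¹ *
        (iidProb (localChart h α Pstar n v) m A * gaussianKernel Pstar v) := fun v => by
    rw [gaussianDensity_eq h hpos]; ring
  simp only [e, tangentLebesgue_eq_volume]
  refine ⟨MeasureTheory.Integrable.const_mul ?_ _, ?_⟩
  · refine hG.mono' (hcont.aestronglyMeasurable.mul hG.aestronglyMeasurable)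
      (Filter.Eventually.of_forall fun v => ?_)
    have hg := (gaussianKernel_pos Pstar v).le
    rw [Real.norm_of_nonneg (mul_nonneg (hnn v) hg)]
    exact mul_le_of_le_one_left hg (hle1 v)
  · rw [MeasureTheory.integral_const_mul, predictiveLaw_eq_sum_types hQ hproj hn1 hmn A]
    refine hn₀ Pstar (fun a => hmin.2 ⟨a, rfl⟩) hproj.1.1.2 n m hmn (le_of_max_le_left hn) hmK ?_ A
      _ hcont hnn hle1 fun v hv => ?_
    · obtain ⟨x, hx⟩ := hne
      exact ⟨_, (mem_constraintEvent_iff hproj.1 hn1 x).1 hx⟩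
    · rw [localChart_eq hproj.1 n v hv]
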